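/- Let $\mathcal A$ be a finite set of attributes; each $A\in\mathcal A$ has an infinite domain $\mathcal D_A$ and an attribute preference $>_A$, a strict total order on $\mathcal D_A$. Let $\mathcal U=\prod_{A}\mathcal D_A$. p-expressions are built from the atoms $>_A$ with the binary operators $\&$ and $\otimes$; $\mathrm{Var}(\pi)$ is the set of attributes occurring in $\pi$, and $o=_X o'$ means $o.A=o'.A$ for all $A\in X$. A p-expression induces a relation on $\mathcal U$: $o\succ_{>_A}o'$ iff $o.A>_A o'.A$; $\succ_{\pi_1\&\pi_2}={\succ_{\pi_1}}\cup({=_{\mathrm{Var}(\pi_1)}}\cap{\succ_{\pi_2}})$; $\succ_{\pi_1\otimes\pi_2}=({\succ_{\pi_1}}\cap{=_{\mathrm{Var}(\pi_2)}})\cup({\succ_{\pi_2}}\cap{=_{\mathrm{Var}(\pi_1)}})\cup({\succ_{\pi_1}}\cap{\succ_{\pi_2}})$. A (full) p-skyline relation is a relation induced by a p-expression in which every attribute occurs exactly once. The skyline relation is the one induced by $>_{A_1}\otimes\dots\otimes>_{A_n}$. A p-extension of a p-skyline relation $\succ$ is a p-skyline relation $\succ'$ (for the same attribute preferences) with $\succ\,\subsetneq\,\succ'$;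 it is minimal if no p-skyline relation $\succ''$ satisfies $\succ\,\subsetneq\,\succ''\,\subsetneq\,\succ'$. A syntax tree of $\succ$ is an ordered rooted tree that represents a p-expression inducing $\succ$, with every attribute exactly once: leaves are labelled by attributes, inner nodes by $\&$ or $\otimes$ (read as $n$-ary operators), and each inner node has at least two children. It is normalized if no inner node has the same label as its parent. (1) There is an absolute constant $C$ such that every p-skyline relation has at most $C|\mathcal A|^4$ minimal p-extensions. (2) In contrast, the total number of p-extensions can be $\Omega(|\mathcal A|!)$: if $|\mathcal A|\ge 2$, the skyline relation has (finitely many and) at least $|\mathcal A|!$ p-extensions. (3) From a normalized syntax tree of a p-skyline relation, a syntax tree of each of its minimal p-extensions can be constructed in time $O(|\mathcal A|)$. Precisely: there are a fixed random access machine program $P$ (unit cost; constants, addition, truncated subtraction, indirect load and store, conditional jump) and constants $k,C$ such that the following holds for every $\mathcal A$, every p-skyline relation $\succ$, every normalized syntax tree $T$ of $\succ$, and every adjacency-list representation of $T$ (linked lists of children) by non-overlapping records at positive addresses below some bound $F$, with attributes encoded by $0,\dots,|\mathcal A|-1$. For every minimal p-extension $\succ_{ext}$ of $\succ$ there are $k$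 parameters, natural numbers less than $F$ (they tell which minimal p-extension to build), such that $P$, started with the address of the root of $T$, $F$, and these parameters, halts after at most $C|\mathcal A|$ steps with an adjacency-list representation, of the same form, of a syntax tree of $\succ_{ext}$ in its memory. -/

import Mathlib

universe u v

/-! ### p-expressions and p-skyline relations -/

/-- The two accumulation operators: prioritized accumulation `&` and Pareto accumulation `⊗`. -/
inductive AccOp where
  | prior
  | pareto

/-- p-expressions over a set `A` of attributes. -/
inductive PExpr (A : Type*) where
  | atom (a : A)
  | acc (o : AccOp) (l r : PExpr A)

namespace PExpr

variable {A : Type*} {D : A → Type*}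

/-- The set of relevant attributes of a p-expression. -/
def vars : PExpr A → Set A
  | atom a => {a}
  | acc _ l r => l.vars ∪ r.vars

/-- The relation on tuples induced by a p-expression, given the attribute preferences `gt a`
(`gt a x y` means that the value `x` is preferred to the value `y`). -/
def rel (gt : ∀ a, D a → D a → Prop) : PExpr A → Set ((∀ a, D a) × (∀ a, D a))
  | atom a => {p | gt a (p.1 a) (p.2 a)}
  | acc .prior l r => l.rel gt ∪ ({p | ∀ a ∈ l.vars, p.1 a = p.2 a} ∩ r.rel gt)
  | acc .pareto l r =>
      (l.rel gt ∩ {p | ∀ a ∈ r.vars, p.1 a = p.2 a}) ∪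
      (r.rel gt ∩ {p | ∀ a ∈ l.vars, p.1 a = p.2 a}) ∪
      (l.rel gt ∩ r.rel gt)

/-- Every attribute occurs at most once: the operands of every accumulation have disjoint sets of
relevant attributes. -/
def IsPSkyline : PExpr A → Prop
  | atom _ => True
  | acc _ l r => Disjoint l.vars r.vars ∧ l.IsPSkyline ∧ r.IsPSkyline

/-- A p-expression that induces a full p-skyline relation. -/
def IsFull (e : PExpr A) : Prop := e.IsPSkyline ∧ e.vars = Set.univ

/-- Only Pareto accumulation occurs. -/
def OnlyPareto : PExpr A → Prop
  | atom _ => True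
  | acc o l r => o = .pareto ∧ l.OnlyPareto ∧ r.OnlyPareto

end PExpr

section Relations

variable {A : Type*} {D : A → Type*}

/-- The set of all full p-skyline relations for the attribute preferences `gt`. -/
def fullPSkyline (gt : ∀ a, D a → D a → Prop) : Set (Set ((∀ a, D a) × (∀ a, D a))) :=
  {R | ∃ e : PExpr A, e.IsFull ∧ e.rel gt = R}

/-- `R` is the skyline relation: the Pareto accumulation of all attribute preferences. -/
def IsSkylineRel (gt : ∀ a, D a → D a → Prop) (R : Set ((∀ a, D a) × (∀ a, D a))) : Prop :=
  ∃ e : PExpr A, e.IsFull ∧ e.OnlyPareto ∧ e.rel gt = R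

/-- The (proper) p-extensions of `R`. -/
def pExtensions (gt : ∀ a, D a → D a → Prop) (R : Set ((∀ a, D a) × (∀ a, D a))) :
    Set (Set ((∀ a, D a) × (∀ a, D a))) :=
  {R' | R' ∈ fullPSkyline gt ∧ R ⊂ R'}

/-- The minimal p-extensions of `R`. -/
def minPExtensions (gt : ∀ a, D a → D a → Prop) (R : Set ((∀ a, D a) × (∀ a, D a))) :
    Set (Set ((∀ a, D a) × (∀ a, D a))) :=
  {R' | R' ∈ pExtensions gt R ∧ ¬ ∃ R'' ∈ fullPSkyline gt, R ⊂ R'' ∧ R'' ⊂ R'}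

end Relations

/-! ### Syntax trees -/

/-- Ordered rooted trees; leaves are labelled by attributes, inner nodes by operators. The children
of an inner node are `c :: cs`, from left to right. -/
inductive SynTree (A : Type*) where
  | leaf (a : A)
  | node (o : AccOp) (c : SynTree A) (cs : List (SynTree A))

namespace SynTree

variable {A : Type*} {D : A → Type*}

mutual
/-- The p-expression represented by a tree: an inner node with children `t₁, …, tₖ` and label `o`
stands for `(…(t₁ o t₂) o …) o tₖ`. -/
def toExpr : SynTree A → PExpr A
  | leaf a => .atom a
  | node o c cs => joinExpr o c.toExpr cs
/-- Accumulates the children in the list onto the p-expression built so far. -/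
def joinExpr (o : AccOp) (e : PExpr A) : List (SynTree A) → PExpr A
  | [] => e
  | t :: ts => joinExpr o (.acc o e t.toExpr) ts
end

/-- The operator at the root, if the root is not a leaf. -/
def rootOp : SynTree A → Option AccOp
  | leaf _ => none
  | node o _ _ => some o

mutual
/-- Every inner node has at least two children. -/
def IsProper : SynTree A → Prop
  | leaf _ => True
  | node _ c cs => cs ≠ [] ∧ c.IsProper ∧ AllProper cs
/-- All trees in the list are proper. -/
def AllProper : List (SynTree A) → Prop
  | [] => True
  | t :: ts => t.IsProper ∧ AllProper ts
end

mutual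
/-- No inner node has the same label as its parent. -/
def IsNormalized : SynTree A → Prop
  | leaf _ => True
  | node o c cs => c.rootOp ≠ some o ∧ c.IsNormalized ∧ AllNormalized o cs
/-- All trees in the list are normalized and their roots are not labelled `o`. -/
def AllNormalized (o : AccOp) : List (SynTree A) → Prop
  | [] => True
  | t :: ts => t.rootOp ≠ some o ∧ t.IsNormalized ∧ AllNormalized o ts
end

/-- `T` is a syntax tree of the full p-skyline relation `R`. -/
def IsSyntaxTreeOf (gt : ∀ a, D a → D a → Prop) (T : SynTree A)
    (R : Set ((∀ a, D a) × (∀ a, D a))) : Prop :=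
  T.IsProper ∧ T.toExpr.IsFull ∧ T.toExpr.rel gt = R

end SynTree

/-! ### Random access machines -/

/-- Instructions of a random access machine with registers `r₀, r₁, …` and a memory of words
addressed by natural numbers. -/
inductive RamInstr where
  /-- `r_i := c` -/
  | const (i c : ℕ)
  /-- `r_i := r_j + r_k` -/
  | add (i j k : ℕ)
  /-- `r_i := r_j - r_k` (truncated at zero) -/
  | sub (i j k : ℕ)
  /-- `r_i := mem[r_j]` -/
  | load (i j : ℕ)
  /-- `mem[r_i] := r_j` -/
  | store (i j : ℕ)
  /-- go to instruction number `l` if `r_j > 0` -/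
  | jpos (j l : ℕ)

/-- Configurations of the machine: program counter, registers, memory. -/
structure RamState where
  pc : ℕ
  reg : ℕ → ℕ
  mem : ℕ → ℕ

namespace RamState

/-- The effect of one instruction. -/
def exec (s : RamState) : RamInstr → RamState
  | .const i c => ⟨s.pc + 1, Function.update s.reg i c, s.mem⟩
  | .add i j k => ⟨s.pc + 1, Function.update s.reg i (s.reg j + s.reg k), s.mem⟩
  | .sub i j k => ⟨s.pc + 1, Function.update s.reg i (s.reg j - s.reg k), s.mem⟩
  | .load i j => ⟨s.pc + 1, Function.update s.reg i (s.mem (s.reg j)), s.mem⟩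
  | .store i j => ⟨s.pc + 1, s.reg, Function.update s.mem (s.reg i) (s.reg j)⟩
  | .jpos j l => ⟨if 0 < s.reg j then l else s.pc + 1, s.reg, s.mem⟩

/-- One step of the program `P`; the machine stays put once it has halted. -/
def step (P : List RamInstr) (s : RamState) : RamState :=
  match P[s.pc]? with
  | some c => s.exec c
  | none => s

/-- The machine has halted: the program counter has left the program. -/
def Halted (P : List RamInstr) (s : RamState) : Prop := P.length ≤ s.pc

/-- The machine started in `s` halts after at most `t` steps, in the configuration `s'`. -/
def HaltsWithin (P : List RamInstr) (t : ℕ) (s s' : RamState) : Prop :=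
  ∃ u ≤ t, (step P)^[u] s = s' ∧ s'.Halted P

end RamState

/-! ### Adjacency-list representation of syntax trees in memory -/

/-- The word that marks an inner node with the given label (leaves are marked `0`). -/
def AccOp.tag : AccOp → ℕ
  | .prior => 1
  | .pareto => 2

namespace SynTree

variable {A : Type*}

mutual
/-- The memory `m` holds the tree at address `p`, using exactly the addresses in the list `S`.
A leaf is the record `(0, code of the attribute)`; an inner node is the record
`(tag, address of its list of children)`. A list of children is a linked list of cells
`(address of the child, address of the next cell)`, where the address `0` marks its end. -/
def StoredAt (m : ℕ → ℕ) (code : A → ℕ) : SynTree A → ℕ → List ℕ → Prop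
  | leaf a, p, S => m p = 0 ∧ m (p + 1) = code a ∧ S = [p, p + 1]
  | node o c cs, p, S => m p = o.tag ∧ m (p + 1) ≠ 0 ∧ ∃ S₁ S₂ : List ℕ,
      StoredAt m code c (m (m (p + 1))) S₁ ∧
      ListStoredAt m code cs (m (m (p + 1) + 1)) S₂ ∧
      S = p :: (p + 1) :: m (p + 1) :: (m (p + 1) + 1) :: (S₁ ++ S₂)
/-- The memory `m` holds at address `q` a linked list of cells with the given trees as children. -/
def ListStoredAt (m : ℕ → ℕ) (code : A → ℕ) : List (SynTree A) → ℕ → List ℕ → Prop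
  | [], q, S => q = 0 ∧ S = []
  | t :: ts, q, S => q ≠ 0 ∧ ∃ S₁ S₂ : List ℕ,
      StoredAt m code t (m q) S₁ ∧ ListStoredAt m code ts (m (q + 1)) S₂ ∧
      S = q :: (q + 1) :: (S₁ ++ S₂)
end

/-- The memory `m` holds the tree `T` with root at address `p`, without overlaps between records,
at positive addresses below `F`. -/
def Layout (m : ℕ → ℕ) (code : A → ℕ) (T : SynTree A) (p F : ℕ) : Prop :=
  ∃ S : List ℕ, T.StoredAt m code p S ∧ S.Nodup ∧ ∀ x ∈ S, 0 < x ∧ x < F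

end SynTree

/-- The initial configuration for the memory contents `m`: the root address is in `r₀`, the first
free address in `r₁`, the `k` parameters `h` in `r₂, …, r_{k+1}`; all other registers are `0`. -/
def ramInit (m : ℕ → ℕ) (root F : ℕ) {k : ℕ} (h : Fin k → ℕ) : RamState where
  pc := 0
  reg i := if i = 0 then root else if i = 1 then F else
    if hi : i - 2 < k then h ⟨i - 2, hi⟩ else 0
  mem := m

/-!
A p-skyline relation is governed by its p-graph, the order on the attributes in which `a` is above
`b` if `a` is more important than `b`: one tuple is preferred to another if it is better somewhere
and every attribute where it is worse lies below one where it is better (`PExpr.mem_rel_iff`). As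
every domain has two elements, containment of relations is containment of p-graphs
(`PExpr.rel_subset_iff`). The p-graphs are the series-parallel orders: any set of at least two
attributes splits into a series or a parallel composition (`PExpr.exists_series_or_parallel`).

The key fact is `SynTree.exists_rewrite`. Let `T` be a normalized tree whose p-graph is properly
contained in that of a p-expression `e`. At a deepest node with new edges between its children,
which is labelled `⊗`, take two children `t₁`, `t₂` joined by a new edge. On their attributes `e`
restricts to a series-parallel order that agrees with `T` on each of them. It is not parallel, since
`t₁` and `t₂` are connected; so it is a series composition, whose cut splits `t₁` into `P₁ & S₁` and
`t₂` into `P₂ & S₂`, where the splits fall between children of `&`-nodes, because leaves and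
`⊗`-nodes cannot be cut. Hence the p-graph obtained by replacing `t₁ ⊗ t₂` by
`(P₁ ⊗ P₂) & (S₁ ⊗ S₂)` lies between those of `T` and `e`. So every minimal p-extension arises by
one such merge.

A merge is determined by two cuts, and a tree has linearly many cuts
(`SynTree.exists_list_hasCut`), which bounds the number of minimal p-extensions even by a quadratic
polynomial (`ncard_minPExtensions_le`). The lower bound for all p-extensions of the skyline relation
comes from the linear orders of the attributes (`factorial_le_ncard_pExtensions`).

A merge changes only a bounded number of words of the adjacency-list representation: two cells are
unlinked, two lists are cut, and a bounded number of new records is allocated. The program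
`RamCmd.merge` does this without loops, given the address of the node, the words that point to the
two cells, and the places of the two cuts (`RamCmd.exists_eval_merge`).
-/

/-! ### The p-graph of a p-expression -/

namespace PExpr

variable {A : Type*} {D : A → Type*}

/-- The p-graph of a p-expression: `e.edge a b` says that `e` makes the attribute `a` more important
than `b`, that is, some `&` in `e` has `a` in its left and `b` in its right operand. -/
def edge : PExpr A → A → A → Prop
  | atom _, _, _ => False
  | acc o l r, a, b => l.edge a b ∨ r.edge a b ∨ (o = .prior ∧ a ∈ l.vars ∧ b ∈ r.vars)

lemma edge_mem {e : PExpr A} {a b : A} (h : e.edge a b) : a ∈ e.vars ∧ b ∈ e.vars := by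
  induction e with
  | atom c => exact h.elim
  | acc o l r ihl ihr =>
    rcases h with h | h | ⟨-, ha, hb⟩
    · exact ⟨.inl (ihl h).1, .inl (ihl h).2⟩
    · exact ⟨.inr (ihr h).1, .inr (ihr h).2⟩
    · exact ⟨.inl ha, .inr hb⟩

lemma vars_nonempty (e : PExpr A) : e.vars.Nonempty := by
  induction e with
  | atom c => exact ⟨c, rfl⟩
  | acc o l r ihl ihr => exact ihl.mono Set.subset_union_left

lemma edge_acc_left {o : AccOp} {l r : PExpr A} (hd : Disjoint l.vars r.vars) {a b : A}
    (hb : b ∈ l.vars) : (acc o l r).edge a b ↔ l.edge a b := by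
  refine ⟨?_, .inl⟩
  rintro (h | h | ⟨-, -, hb'⟩)
  · exact h
  · exact (Set.disjoint_left.1 hd hb (edge_mem h).2).elim
  · exact (Set.disjoint_left.1 hd hb hb').elim

lemma edge_acc_right {o : AccOp} {l r : PExpr A} (hd : Disjoint l.vars r.vars) {a b : A}
    (ha : a ∈ r.vars) : (acc o l r).edge a b ↔ r.edge a b := by
  refine ⟨?_, fun h => .inr (.inl h)⟩
  rintro (h | h | ⟨-, ha', -⟩)
  · exact (Set.disjoint_left.1 hd (edge_mem h).1 ha).elim
  · exact h
  · exact (Set.disjoint_left.1 hd ha' ha).elim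

lemma edge_asymm {e : PExpr A} (he : e.IsPSkyline) {a b : A} (h : e.edge a b) :
    ¬ e.edge b a := by
  induction e with
  | atom c => exact h.elim
  | acc o l r ihl ihr =>
    obtain ⟨hd, hl, hr⟩ := he
    intro h'
    rcases h with h | h | ⟨-, ha, hb⟩
    · exact ihl hl h ((edge_acc_left hd (edge_mem h).1).1 h')
    · exact ihr hr h ((edge_acc_right hd (edge_mem h).2).1 h')
    · exact Set.disjoint_left.1 hd (edge_mem ((edge_acc_left hd ha).1 h')).1 hb

lemma ne_of_edge {e : PExpr A} (he : e.IsPSkyline) {a b : A} (h : e.edge a b) : a ≠ b := by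
  rintro rfl
  exact edge_asymm he h h

/-- The p-graph is a series-parallel order: every set of at least two attributes falls into two
disjoint parts such that either all of the first is above all of the second, or nothing is related
across the parts. -/
lemma exists_series_or_parallel {e : PExpr A} (he : e.IsPSkyline) {W : Set A}
    (hW : W ⊆ e.vars) (hn : W.Nontrivial) :
    ∃ U V : Set A, U.Nonempty ∧ V.Nonempty ∧ Disjoint U V ∧ U ∪ V = W ∧
      ((∀ a ∈ U, ∀ b ∈ V, e.edge a b) ∨ ∀ a ∈ U, ∀ b ∈ V, ¬ e.edge a b ∧ ¬ e.edge b a) := by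
  induction e with
  | atom c => exact (hn.not_subsingleton (Set.subsingleton_singleton.anti hW)).elim
  | acc o l r ihl ihr =>
    obtain ⟨hd, hl, hr⟩ := he
    by_cases h1 : W ⊆ l.vars
    · obtain ⟨U, V, hU, hV, hdUV, hUV, h⟩ := ihl hl h1
      refine ⟨U, V, hU, hV, hdUV, hUV, h.imp (fun h a ha b hb => .inl (h a ha b hb)) ?_⟩
      intro h a ha b hb
      have ha' := h1 (hUV ▸ Set.mem_union_left V ha)
      have hb' := h1 (hUV ▸ Set.mem_union_right U hb)
      rw [edge_acc_left hd hb', edge_acc_left hd ha']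
      exact h a ha b hb
    by_cases h2 : W ⊆ r.vars
    · obtain ⟨U, V, hU, hV, hdUV, hUV, h⟩ := ihr hr h2
      refine ⟨U, V, hU, hV, hdUV, hUV, h.imp (fun h a ha b hb => .inr (.inl (h a ha b hb))) ?_⟩
      intro h a ha b hb
      have ha' := h2 (hUV ▸ Set.mem_union_left V ha)
      have hb' := h2 (hUV ▸ Set.mem_union_right U hb)
      rw [edge_acc_right hd ha', edge_acc_right hd hb']
      exact h a ha b hb
    obtain ⟨x, hx, hxl⟩ := Set.not_subset.1 h1
    obtain ⟨y, hy, hyr⟩ := Set.not_subset.1 h2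
    refine ⟨W ∩ l.vars, W ∩ r.vars, ⟨y, hy, (hW hy).resolve_right hyr⟩,
      ⟨x, hx, (hW hx).resolve_left hxl⟩,
      hd.mono Set.inter_subset_right Set.inter_subset_right, ?_, ?_⟩
    · rw [← Set.inter_union_distrib_left]
      exact Set.inter_eq_left.2 hW
    · cases o with
      | prior => exact .inl fun a ha b hb => .inr (.inr ⟨rfl, ha.2, hb.2⟩)
      | pareto =>
        refine .inr fun a ha b hb => ⟨?_, ?_⟩
        · rintro (h | h | ⟨h, -, -⟩)
          · exact Set.disjoint_left.1 hd (edge_mem h).2 hb.2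
          · exact Set.disjoint_left.1 hd ha.2 (edge_mem h).1
          · cases h
        · rintro (h | h | ⟨h, -, -⟩)
          · exact Set.disjoint_left.1 hd (edge_mem h).1 hb.2
          · exact Set.disjoint_left.1 hd ha.2 (edge_mem h).2
          · cases h

/-- The relation on tuples given by a graph on the attributes: a tuple is preferred if it is better
somewhere and every attribute where it is worse is dominated by one where it is better. -/
def graphRel (gt : ∀ a, D a → D a → Prop) (E : A → A → Prop) :
    Set ((∀ a, D a) × (∀ a, D a)) :=
  {p | (∃ a, gt a (p.1 a) (p.2 a)) ∧
    ∀ b, gt b (p.2 b) (p.1 b) → ∃ a, E a b ∧ gt a (p.1 a) (p.2 a)}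

variable (gt : ∀ a, D a → D a → Prop) [∀ a, IsStrictTotalOrder (D a) (gt a)]

lemma mem_rel_iff {e : PExpr A} (he : e.IsPSkyline) (x y : ∀ a, D a) :
    (x, y) ∈ e.rel gt ↔ (∃ a ∈ e.vars, gt a (x a) (y a)) ∧
      ∀ b ∈ e.vars, gt b (y b) (x b) → ∃ a, e.edge a b ∧ gt a (x a) (y a) := by
  have irr : ∀ a (z : D a), ¬ gt a z z := fun a z => irrefl_of (gt a) z
  have asy : ∀ a (z w : D a), gt a z w → ¬ gt a w z := fun a z w => asymm_of (gt a)
  -- If the tuples differ on `e.vars` and all worse attributes are dominated, one is better.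
  have better : ∀ e : PExpr A, (¬ ∀ a ∈ e.vars, x a = y a) →
      (∀ b ∈ e.vars, gt b (y b) (x b) → ∃ a, e.edge a b ∧ gt a (x a) (y a)) →
      ∃ a ∈ e.vars, gt a (x a) (y a) := by
    intro e hne h
    push Not at hne
    obtain ⟨a, ha, hxy⟩ := hne
    rcases trichotomous_of (gt a) (x a) (y a) with h1 | h1 | h1
    · exact ⟨a, ha, h1⟩
    · exact (hxy h1).elim
    · obtain ⟨c, hc, hg⟩ := h a ha h1
      exact ⟨c, (edge_mem hc).1, hg⟩
  induction e with
  | atom c =>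
    simp only [rel, vars, Set.mem_ofPred_eq, Set.mem_singleton_iff, exists_eq_left, edge,
      false_and, exists_false, imp_false, forall_eq]
    exact ⟨fun h => ⟨h, asy _ _ _ h⟩, fun h => h.1⟩
  | acc o l r ihl ihr =>
    obtain ⟨hd, hl, hr⟩ := he
    -- The conditions for the two operands, read off from those for the whole expression.
    have condl : (∀ b ∈ (acc o l r).vars, gt b (y b) (x b) →
        ∃ a, (acc o l r).edge a b ∧ gt a (x a) (y a)) →
        ∀ b ∈ l.vars, gt b (y b) (x b) → ∃ a, l.edge a b ∧ gt a (x a) (y a) := by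
      intro h b hb hg
      obtain ⟨a, ha, hga⟩ := h b (.inl hb) hg
      exact ⟨a, (edge_acc_left hd hb).1 ha, hga⟩
    have condr : (o = .prior → ∀ a ∈ l.vars, x a = y a) →
        (∀ b ∈ (acc o l r).vars, gt b (y b) (x b) →
        ∃ a, (acc o l r).edge a b ∧ gt a (x a) (y a)) →
        ∀ b ∈ r.vars, gt b (y b) (x b) → ∃ a, r.edge a b ∧ gt a (x a) (y a) := by
      intro heq h b hb hg
      obtain ⟨a, ha | ha | ⟨ho, ha, -⟩, hga⟩ := h b (.inr hb) hg
      · exact (Set.disjoint_left.1 hd (edge_mem ha).2 hb).elim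
      · exact ⟨a, ha, hga⟩
      · rw [heq ho a ha] at hga
        exact (irr _ _ hga).elim
    -- And conversely.
    have conds : (∀ b ∈ l.vars, gt b (y b) (x b) → ∃ a, l.edge a b ∧ gt a (x a) (y a)) →
        (∀ b ∈ r.vars, gt b (y b) (x b) → ∃ a, r.edge a b ∧ gt a (x a) (y a)) →
        ∀ b ∈ (acc o l r).vars, gt b (y b) (x b) →
        ∃ a, (acc o l r).edge a b ∧ gt a (x a) (y a) := by
      rintro h1 h2 b (hb | hb) hg
      · obtain ⟨a, ha, hga⟩ := h1 b hb hg
        exact ⟨a, .inl ha, hga⟩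
      · obtain ⟨a, ha, hga⟩ := h2 b hb hg
        exact ⟨a, .inr (.inl ha), hga⟩
    have eqcond : ∀ e : PExpr A, (∀ a ∈ e.vars, x a = y a) →
        ∀ b ∈ e.vars, gt b (y b) (x b) → ∃ a, e.edge a b ∧ gt a (x a) (y a) := by
      intro e h b hb hg
      rw [h b hb] at hg
      exact (irr _ _ hg).elim
    have noneq : ∀ e : PExpr A, (∀ a ∈ e.vars, x a = y a) →
        ¬ ∃ a ∈ e.vars, gt a (x a) (y a) := by
      rintro e h ⟨a, ha, hg⟩
      rw [h a ha] at hg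
      exact irr _ _ hg
    cases o with
    | prior =>
      simp only [rel, Set.mem_union, Set.mem_inter_iff, Set.mem_ofPred_eq, ihl hl, ihr hr]
      constructor
      · rintro (⟨⟨a, ha, hg⟩, h⟩ | ⟨heq, ⟨a, ha, hg⟩, h⟩)
        · refine ⟨⟨a, .inl ha, hg⟩, ?_⟩
          rintro b (hb | hb) hgb
          · obtain ⟨c, hc, hgc⟩ := h b hb hgb
            exact ⟨c, .inl hc, hgc⟩
          · exact ⟨a, .inr (.inr ⟨rfl, ha, hb⟩), hg⟩
        · exact ⟨⟨a, .inr ha, hg⟩, conds (eqcond l heq) h⟩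
      · rintro ⟨⟨a, ha, hg⟩, h⟩
        by_cases heq : ∀ a ∈ l.vars, x a = y a
        · refine .inr ⟨heq, ?_, condr (fun _ => heq) h⟩
          rcases ha with ha | ha
          · exact (noneq l heq ⟨a, ha, hg⟩).elim
          · exact ⟨a, ha, hg⟩
        · exact .inl ⟨better l heq (condl h), condl h⟩
    | pareto =>
      simp only [rel, Set.mem_union, Set.mem_inter_iff, Set.mem_ofPred_eq, ihl hl, ihr hr]
      constructor
      · rintro ((⟨⟨⟨a, ha, hg⟩, h⟩, heq⟩ | ⟨⟨⟨a, ha, hg⟩, h⟩, heq⟩) | ⟨⟨⟨a, ha, hg⟩, h⟩, -, h'⟩)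
        · exact ⟨⟨a, .inl ha, hg⟩, conds h (eqcond r heq)⟩
        · exact ⟨⟨a, .inr ha, hg⟩, conds (eqcond l heq) h⟩
        · exact ⟨⟨a, .inl ha, hg⟩, conds h h'⟩
      · rintro ⟨⟨a, ha, hg⟩, h⟩
        have hl' := condl h
        have hr' := condr (fun h => by cases h) h
        by_cases heql : ∀ a ∈ l.vars, x a = y a
        · refine .inl (.inr ⟨⟨?_, hr'⟩, heql⟩)
          rcases ha with ha | ha
          · exact (noneq l heql ⟨a, ha, hg⟩).elim
          · exact ⟨a, ha, hg⟩
        by_cases heqr : ∀ a ∈ r.vars, x a = y a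
        · exact .inl (.inl ⟨⟨better l heql hl', hl'⟩, heqr⟩)
        exact .inr ⟨⟨better l heql hl', hl'⟩, better r heqr hr', hr'⟩

/-- A full p-skyline relation is determined by its p-graph. -/
lemma rel_eq_graphRel {e : PExpr A} (he : e.IsFull) : e.rel gt = graphRel gt e.edge := by
  ext ⟨x, y⟩
  rw [mem_rel_iff gt he.1, he.2]
  simp [graphRel]

/-- Containment of p-skyline relations is containment of p-graphs. An edge from `a` to `b` is
witnessed by two tuples of which the one is better in `a`, worse in `b`, and equal elsewhere. -/
lemma rel_subset_iff [∀ a, Infinite (D a)] {e e' : PExpr A} (he : e.IsFull) (he' : e'.IsFull) :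
    e.rel gt ⊆ e'.rel gt ↔ ∀ a b, e.edge a b → e'.edge a b := by
  classical
  rw [rel_eq_graphRel gt he, rel_eq_graphRel gt he']
  constructor
  · intro h a b hab
    have : ∀ a, ∃ p : D a × D a, gt a p.1 p.2 := by
      intro a
      obtain ⟨p, q, hpq⟩ := exists_pair_ne (D a)
      rcases trichotomous_of (gt a) p q with h1 | h1 | h1
      exacts [⟨(p, q), h1⟩, (hpq h1).elim, ⟨(q, p), h1⟩]
    choose p hp using this
    have hne := ne_of_edge he.1 hab
    have hmem : (Function.update (fun c => (p c).2) a (p a).1,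
        Function.update (fun c => (p c).2) b (p b).1) ∈ graphRel gt e.edge := by
      refine ⟨⟨a, by simpa [hne] using hp a⟩, fun c hc => ⟨a, ?_, by simpa [hne] using hp a⟩⟩
      by_cases hcb : c = b
      · exact hcb ▸ hab
      · by_cases hca : c = a
        · subst hca
          simp only [Function.update_self, Function.update_of_ne hcb] at hc
          exact (asymm_of (gt c) hc (hp c)).elim
        · simp only [Function.update_of_ne hcb, Function.update_of_ne hca] at hc
          exact (irrefl_of (gt c) _ hc).elim
    obtain ⟨c, hc, hg⟩ := (h hmem).2 b (by simpa [hne.symm] using hp b)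
    by_cases hca : c = a
    · exact hca ▸ hc
    · by_cases hcb : c = b
      · exact (ne_of_edge he'.1 hc hcb).elim
      · simp only [Function.update_of_ne hcb, Function.update_of_ne hca] at hg
        exact (irrefl_of (gt c) _ hg).elim
  · rintro h ⟨x, y⟩ ⟨h1, h2⟩
    refine ⟨h1, fun b hb => ?_⟩
    obtain ⟨a, ha, hg⟩ := h2 b hb
    exact ⟨a, h _ _ ha, hg⟩

end PExpr

/-- There are only finitely many full p-skyline relations, as there are only finitely many graphs
on the attributes. -/
lemma finite_fullPSkyline {A : Type*} [Finite A] {D : A → Type*} (gt : ∀ a, D a → D a → Prop)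
    [∀ a, IsStrictTotalOrder (D a) (gt a)] : (fullPSkyline gt).Finite := by
  refine (Set.finite_range (PExpr.graphRel gt)).subset ?_
  rintro R ⟨e, he, rfl⟩
  exact ⟨e.edge, (PExpr.rel_eq_graphRel gt he).symm⟩

/-! ### Forests of syntax trees -/

namespace SynTree

variable {A : Type*} {D : A → Type*}

/-- Structural induction on syntax trees, the children of a node taken together. -/
theorem inductionOn {p : SynTree A → Prop} (t : SynTree A) (leaf : ∀ a, p (leaf a))
    (node : ∀ o c cs, (∀ t ∈ c :: cs, p t) → p (node o c cs)) : p t :=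
  SynTree.rec (motive_1 := p) (motive_2 := fun ts => ∀ t ∈ ts, p t) leaf
    (fun o c cs hc hcs => node o c cs (List.forall_mem_cons.2 ⟨hc, hcs⟩))
    (by simp) (fun _ _ ht hts => List.forall_mem_cons.2 ⟨ht, hts⟩) t

/-- The attributes occurring in a tree. -/
def vars (t : SynTree A) : Set A := t.toExpr.vars

/-- The p-graph of a tree. -/
def edge (t : SynTree A) : A → A → Prop := t.toExpr.edge

/-- The attributes occurring in a list of trees. -/
def forestVars : List (SynTree A) → Set A
  | [] => ∅
  | t :: ts => t.vars ∪ forestVars ts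

/-- The p-graph of a list of trees accumulated with the operator `o`. -/
def forestEdge (o : AccOp) : List (SynTree A) → A → A → Prop
  | [], _, _ => False
  | t :: ts, a, b => t.edge a b ∨ forestEdge o ts a b ∨
      (o = .prior ∧ a ∈ t.vars ∧ b ∈ forestVars ts)

/-- The tree is proper and no attribute occurs twice in it. -/
def Valid (t : SynTree A) : Prop := t.IsProper ∧ t.toExpr.IsPSkyline

/-- The trees in the list are proper and no attribute occurs twice in them. -/
def ForestValid : List (SynTree A) → Prop
  | [] => True
  | t :: ts => t.Valid ∧ Disjoint t.vars (forestVars ts) ∧ ForestValid ts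

lemma mem_forestVars {ts : List (SynTree A)} {a : A} :
    a ∈ forestVars ts ↔ ∃ t ∈ ts, a ∈ t.vars := by
  induction ts with
  | nil => simp [forestVars]
  | cons t ts ih => simp [forestVars, ih]

lemma forestVars_append (l₁ l₂ : List (SynTree A)) :
    forestVars (l₁ ++ l₂) = forestVars l₁ ∪ forestVars l₂ := by
  ext a
  simp only [mem_forestVars, List.mem_append, Set.mem_union, or_and_right, exists_or]

lemma forestVars_singleton (t : SynTree A) : forestVars [t] = t.vars := by
  simp [forestVars]

lemma vars_nonempty (t : SynTree A) : t.vars.Nonempty := PExpr.vars_nonempty _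

lemma forestVars_nonempty {ts : List (SynTree A)} (h : ts ≠ []) : (forestVars ts).Nonempty := by
  obtain ⟨t, ts, rfl⟩ := List.exists_cons_of_ne_nil h
  exact t.vars_nonempty.mono Set.subset_union_left

lemma edge_mem {t : SynTree A} {a b : A} (h : t.edge a b) : a ∈ t.vars ∧ b ∈ t.vars :=
  PExpr.edge_mem h

lemma forestEdge_mem {o : AccOp} {ts : List (SynTree A)} {a b : A} (h : forestEdge o ts a b) :
    a ∈ forestVars ts ∧ b ∈ forestVars ts := by
  induction ts with
  | nil => exact h.elim
  | cons t ts ih =>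
    rcases h with h | h | ⟨-, ha, hb⟩
    · exact ⟨.inl (edge_mem h).1, .inl (edge_mem h).2⟩
    · exact ⟨.inr (ih h).1, .inr (ih h).2⟩
    · exact ⟨.inl ha, .inr hb⟩

lemma forestEdge_append {o : AccOp} {l₁ l₂ : List (SynTree A)} {a b : A} :
    forestEdge o (l₁ ++ l₂) a b ↔ forestEdge o l₁ a b ∨ forestEdge o l₂ a b ∨
      (o = .prior ∧ a ∈ forestVars l₁ ∧ b ∈ forestVars l₂) := by
  induction l₁ with
  | nil => simp [forestEdge, forestVars]
  | cons t ts ih =>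
    simp only [List.cons_append, forestEdge, ih, forestVars_append, forestVars, Set.mem_union]
    tauto

lemma forestEdge_singleton {o : AccOp} {t : SynTree A} {a b : A} :
    forestEdge o [t] a b ↔ t.edge a b := by
  simp [forestEdge, forestVars]

lemma forestEdge_of_mem {o : AccOp} {ts : List (SynTree A)} {t : SynTree A} (ht : t ∈ ts)
    {a b : A} (h : t.edge a b) : forestEdge o ts a b := by
  obtain ⟨l₁, l₂, rfl⟩ := List.append_of_mem ht
  exact forestEdge_append.2 (.inr (.inl (.inl h)))

lemma forestValid_append {l₁ l₂ : List (SynTree A)} : ForestValid (l₁ ++ l₂) ↔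
    ForestValid l₁ ∧ ForestValid l₂ ∧ Disjoint (forestVars l₁) (forestVars l₂) := by
  induction l₁ with
  | nil => simp [ForestValid, forestVars]
  | cons t ts ih =>
    simp only [List.cons_append, ForestValid, ih, forestVars_append, forestVars,
      Set.disjoint_union_left, Set.disjoint_union_right]
    tauto

lemma forestValid_singleton {t : SynTree A} : ForestValid [t] ↔ t.Valid := by
  simp [ForestValid, forestVars]

lemma ForestValid.valid_of_mem {ts : List (SynTree A)} (h : ForestValid ts) {t : SynTree A}
    (ht : t ∈ ts) : t.Valid := by
  obtain ⟨l₁, l₂, rfl⟩ := List.append_of_mem ht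
  exact (forestValid_append.1 h).2.1.1

lemma vars_leaf (a : A) : (leaf a).vars = {a} := by simp [vars, toExpr, PExpr.vars]

lemma vars_joinExpr (o : AccOp) (e : PExpr A) (ts : List (SynTree A)) :
    (joinExpr o e ts).vars = e.vars ∪ forestVars ts := by
  induction ts generalizing e with
  | nil => simp [joinExpr, forestVars]
  | cons t ts ih => simp [joinExpr, ih, forestVars, PExpr.vars, vars, Set.union_assoc]

lemma edge_joinExpr (o : AccOp) (e : PExpr A) (ts : List (SynTree A)) (a b : A) :
    (joinExpr o e ts).edge a b ↔ e.edge a b ∨ forestEdge o ts a b ∨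
      (o = .prior ∧ a ∈ e.vars ∧ b ∈ forestVars ts) := by
  induction ts generalizing e with
  | nil => simp [joinExpr, forestVars, forestEdge]
  | cons t ts ih =>
    simp only [joinExpr, ih, forestVars, PExpr.edge, PExpr.vars, forestEdge, edge, vars,
      Set.mem_union]
    tauto

lemma isPSkyline_joinExpr (o : AccOp) (e : PExpr A) (ts : List (SynTree A)) :
    (joinExpr o e ts).IsPSkyline ∧ AllProper ts ↔
      e.IsPSkyline ∧ Disjoint e.vars (forestVars ts) ∧ ForestValid ts := by
  induction ts generalizing e with
  | nil => simp [joinExpr, forestVars, ForestValid, AllProper]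
  | cons t ts ih =>
    have := ih (.acc o e t.toExpr)
    simp only [PExpr.IsPSkyline, PExpr.vars, Set.disjoint_union_left] at this
    simp only [joinExpr, forestVars, ForestValid, Valid, AllProper, vars, Set.disjoint_union_right]
    tauto

lemma vars_node (o : AccOp) (c : SynTree A) (cs : List (SynTree A)) :
    (node o c cs).vars = forestVars (c :: cs) := by
  simp only [vars, toExpr, vars_joinExpr, forestVars]

lemma edge_node {o : AccOp} {c : SynTree A} {cs : List (SynTree A)} {a b : A} :
    (node o c cs).edge a b ↔ forestEdge o (c :: cs) a b := by
  simp only [edge, vars, toExpr, edge_joinExpr, forestEdge]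

lemma valid_node {o : AccOp} {c : SynTree A} {cs : List (SynTree A)} :
    (node o c cs).Valid ↔ cs ≠ [] ∧ ForestValid (c :: cs) := by
  have := isPSkyline_joinExpr o c.toExpr cs
  simp only [Valid, toExpr, IsProper, ForestValid, vars]
  tauto

lemma valid_leaf (a : A) : (leaf a).Valid := by
  simp [Valid, toExpr, IsProper, PExpr.IsPSkyline]

lemma allNormalized_iff {o : AccOp} {ts : List (SynTree A)} :
    AllNormalized o ts ↔ ∀ t ∈ ts, t.rootOp ≠ some o ∧ t.IsNormalized := by
  induction ts with
  | nil => simp [AllNormalized]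
  | cons t ts ih => simp [AllNormalized, ih, and_assoc]

lemma isNormalized_node {o : AccOp} {c : SynTree A} {cs : List (SynTree A)} :
    (node o c cs).IsNormalized ↔ ∀ t ∈ c :: cs, t.rootOp ≠ some o ∧ t.IsNormalized := by
  rw [List.forall_mem_cons, ← allNormalized_iff, IsNormalized, and_assoc]

/-- Within the attributes of a member of a forest, the p-graph of the forest is that of the
member. -/
lemma forestEdge_iff_of_mem {o : AccOp} {ts : List (SynTree A)} (h : ForestValid ts)
    {t : SynTree A} (ht : t ∈ ts) {a b : A} (ha : a ∈ t.vars) (hb : b ∈ t.vars) :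
    forestEdge o ts a b ↔ t.edge a b := by
  refine ⟨fun hE => ?_, forestEdge_of_mem ht⟩
  obtain ⟨l₁, l₂, rfl⟩ := List.append_of_mem ht
  obtain ⟨-, ⟨-, h2, -⟩, h1⟩ := forestValid_append.1 h
  simp only [forestVars, Set.disjoint_union_right] at h1
  rcases forestEdge_append.1 hE with hE | (hE | hE | ⟨-, -, hE⟩) | ⟨-, hE, -⟩
  · exact (Set.disjoint_left.1 h1.1 (forestEdge_mem hE).1 ha).elim
  · exact hE
  · exact (Set.disjoint_left.1 h2 ha (forestEdge_mem hE).1).elim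
  · exact (Set.disjoint_left.1 h2 hb hE).elim
  · exact (Set.disjoint_left.1 h1.1 hE ha).elim

/-- If two attributes lie in different members of a forest, one of the members comes first. -/
lemma exists_split_of_ne {ts : List (SynTree A)} {t₁ t₂ : SynTree A} (h₁ : t₁ ∈ ts)
    (h₂ : t₂ ∈ ts) (hne : t₁ ≠ t₂) :
    (∃ l₁ l₂ l₃, ts = l₁ ++ t₁ :: l₂ ++ t₂ :: l₃) ∨
      ∃ l₁ l₂ l₃, ts = l₁ ++ t₂ :: l₂ ++ t₁ :: l₃ := by
  obtain ⟨l₁, l₂, rfl⟩ := List.append_of_mem h₁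
  rcases List.mem_append.1 h₂ with h | h
  · obtain ⟨m₁, m₂, rfl⟩ := List.append_of_mem h
    exact .inr ⟨m₁, m₂, l₂, rfl⟩
  · obtain ⟨m₁, m₂, rfl⟩ := List.append_of_mem ((List.mem_cons.1 h).resolve_left hne.symm)
    exact .inl ⟨l₁, m₁, m₂, by simp⟩

/-- The operands of a prioritized accumulation are comparable. -/
lemma forestEdge_prior_of_ne {ts : List (SynTree A)} {t₁ t₂ : SynTree A} (h₁ : t₁ ∈ ts)
    (h₂ : t₂ ∈ ts) (hne : t₁ ≠ t₂) {a b : A} (ha : a ∈ t₁.vars) (hb : b ∈ t₂.vars) :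
    forestEdge .prior ts a b ∨ forestEdge .prior ts b a := by
  rcases exists_split_of_ne h₁ h₂ hne with ⟨l₁, l₂, l₃, rfl⟩ | ⟨l₁, l₂, l₃, rfl⟩
  · left
    rw [forestEdge_append]
    simp [forestVars, forestVars_append, ha, hb]
  · right
    rw [forestEdge_append]
    simp [forestVars, forestVars_append, ha, hb]

/-- The operands of a Pareto accumulation are incomparable. -/
lemma exists_mem_of_forestEdge_pareto {ts : List (SynTree A)} {a b : A}
    (h : forestEdge .pareto ts a b) : ∃ t ∈ ts, t.edge a b := by
  induction ts with
  | nil => exact h.elim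
  | cons t ts ih =>
    rcases h with h | h | ⟨h, -, -⟩
    · exact ⟨t, by simp, h⟩
    · obtain ⟨s, hs, h⟩ := ih h
      exact ⟨s, by simp [hs], h⟩
    · cases h

lemma eq_of_mem_vars {ts : List (SynTree A)} (h : ForestValid ts) {t₁ t₂ : SynTree A}
    (h₁ : t₁ ∈ ts) (h₂ : t₂ ∈ ts) {a : A} (ha₁ : a ∈ t₁.vars) (ha₂ : a ∈ t₂.vars) :
    t₁ = t₂ := by
  by_contra hne
  wlog hs : ∃ l₁ l₂ l₃, ts = l₁ ++ t₁ :: l₂ ++ t₂ :: l₃ generalizing t₁ t₂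
  · exact this h₂ h₁ ha₂ ha₁ (Ne.symm hne) ((exists_split_of_ne h₁ h₂ hne).resolve_left hs)
  obtain ⟨l₁, l₂, l₃, rfl⟩ := hs
  have := (forestValid_append.1 h).2.2
  simp only [forestVars_append, forestVars] at this
  exact Set.disjoint_left.1 this (.inr (.inl ha₁)) (.inl ha₂)

/-- A node with at least two operands has an operand that avoids a given one. -/
lemma exists_mem_ne {ts : List (SynTree A)} {c : SynTree A} (h : ForestValid (c :: ts))
    (hts : ts ≠ []) (t : SynTree A) : ∃ s ∈ c :: ts, s ≠ t := by
  by_cases hc : c = t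
  · obtain ⟨d, ds, rfl⟩ := List.exists_cons_of_ne_nil hts
    refine ⟨d, by simp, ?_⟩
    rintro rfl
    subst hc
    obtain ⟨a, ha⟩ := c.vars_nonempty
    exact Set.disjoint_left.1 h.2.1 ha (.inl ha)
  · exact ⟨c, by simp, hc⟩

/-- A tree whose root is not labelled `⊗` has a connected p-graph: if its attributes are
covered by two sets without relations across, one of the sets contains them all. -/
lemma subset_or_subset_of_not_pareto {t : SynTree A} (ht : t.Valid)
    (hr : t.rootOp ≠ some .pareto) {U V : Set A} (hUV : t.vars ⊆ U ∪ V)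
    (h : ∀ a ∈ t.vars ∩ U, ∀ b ∈ t.vars ∩ V, ¬ t.edge a b ∧ ¬ t.edge b a) :
    t.vars ⊆ U ∨ t.vars ⊆ V := by
  by_contra! hc
  obtain ⟨y, hy, hyU⟩ := Set.not_subset.1 hc.1
  obtain ⟨x, hx, hxV⟩ := Set.not_subset.1 hc.2
  have hyV := (hUV hy).resolve_left hyU
  have hxU := (hUV hx).resolve_right hxV
  cases t with
  | leaf a =>
    rw [vars_leaf] at hx hy
    exact hxV ((Set.mem_singleton_iff.1 hx).trans (Set.mem_singleton_iff.1 hy).symm ▸ hyV)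
  | node o c cs =>
    cases o with
    | pareto => exact hr rfl
    | prior =>
      obtain ⟨hcs, hv⟩ := valid_node.1 ht
      have key : ∀ t₁ ∈ c :: cs, ∀ t₂ ∈ c :: cs, t₁ ≠ t₂ → ∀ a ∈ t₁.vars, ∀ b ∈ t₂.vars,
          a ∈ U → b ∉ V := by
        intro t₁ h₁ t₂ h₂ hne a ha b hb haU hbV
        have := h a ⟨by rw [vars_node]; exact mem_forestVars.2 ⟨_, h₁, ha⟩, haU⟩ b
          ⟨by rw [vars_node]; exact mem_forestVars.2 ⟨_, h₂, hb⟩, hbV⟩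
        rw [edge_node, edge_node] at this
        exact (forestEdge_prior_of_ne h₁ h₂ hne ha hb).elim this.1 this.2
      rw [vars_node] at hx hy
      obtain ⟨t₁, h₁, hx⟩ := mem_forestVars.1 hx
      obtain ⟨t₂, h₂, hy⟩ := mem_forestVars.1 hy
      by_cases hne : t₁ = t₂
      · subst hne
        obtain ⟨s, hs, hst⟩ := exists_mem_ne hv hcs t₁
        obtain ⟨z, hz⟩ := s.vars_nonempty
        rcases hUV (by rw [vars_node]; exact mem_forestVars.2 ⟨_, hs, hz⟩) with hzU | hzV
        · exact key s hs t₁ h₁ hst z hz y hy hzU hyV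
        · exact key t₁ h₁ s hs hst.symm x hx z hz hxU hzV
      · exact key t₁ h₁ t₂ h₂ hne x hx y hy hxU hyV

/-- A tree whose root is not labelled `&` cannot be cut into an upper and a lower part. -/
lemma subset_or_subset_of_not_prior {t : SynTree A} (ht : t.Valid)
    (hr : t.rootOp ≠ some .prior) {U V : Set A} (hUV : t.vars ⊆ U ∪ V)
    (h : ∀ a ∈ t.vars ∩ U, ∀ b ∈ t.vars ∩ V, t.edge a b) :
    t.vars ⊆ U ∨ t.vars ⊆ V := by
  by_contra! hc
  obtain ⟨y, hy, hyU⟩ := Set.not_subset.1 hc.1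
  obtain ⟨x, hx, hxV⟩ := Set.not_subset.1 hc.2
  have hyV := (hUV hy).resolve_left hyU
  have hxU := (hUV hx).resolve_right hxV
  cases t with
  | leaf a =>
    rw [vars_leaf] at hx hy
    exact hxV ((Set.mem_singleton_iff.1 hx).trans (Set.mem_singleton_iff.1 hy).symm ▸ hyV)
  | node o c cs =>
    cases o with
    | prior => exact hr rfl
    | pareto =>
      obtain ⟨hcs, hv⟩ := valid_node.1 ht
      have key : ∀ t₁ ∈ c :: cs, ∀ t₂ ∈ c :: cs, t₁ ≠ t₂ → ∀ a ∈ t₁.vars, ∀ b ∈ t₂.vars,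
          a ∈ U → b ∉ V := by
        intro t₁ h₁ t₂ h₂ hne a ha b hb haU hbV
        have := h a ⟨by rw [vars_node]; exact mem_forestVars.2 ⟨_, h₁, ha⟩, haU⟩ b
          ⟨by rw [vars_node]; exact mem_forestVars.2 ⟨_, h₂, hb⟩, hbV⟩
        rw [edge_node] at this
        obtain ⟨t, ht, hE⟩ := exists_mem_of_forestEdge_pareto this
        exact hne ((eq_of_mem_vars hv h₁ ht ha (edge_mem hE).1).trans
          (eq_of_mem_vars hv h₂ ht hb (edge_mem hE).2).symm)
      rw [vars_node] at hx hy
      obtain ⟨t₁, h₁, hx⟩ := mem_forestVars.1 hx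
      obtain ⟨t₂, h₂, hy⟩ := mem_forestVars.1 hy
      by_cases hne : t₁ = t₂
      · subst hne
        obtain ⟨s, hs, hst⟩ := exists_mem_ne hv hcs t₁
        obtain ⟨z, hz⟩ := s.vars_nonempty
        rcases hUV (by rw [vars_node]; exact mem_forestVars.2 ⟨_, hs, hz⟩) with hzU | hzV
        · exact key s hs t₁ h₁ hst z hz y hy hzU hyV
        · exact key t₁ h₁ s hs hst.symm x hx z hz hxU hzV
      · exact key t₁ h₁ t₂ h₂ hne x hx y hy hxU hyV

/-! ### Cutting prioritized accumulations -/

/-- The operands of a tree read as an accumulation by `o`: the children of the root if it is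
labelled `o`, otherwise the tree itself as the only operand. -/
def factors : AccOp → SynTree A → List (SynTree A)
  | .prior, node .prior c cs => c :: cs
  | .pareto, node .pareto c cs => c :: cs
  | _, t => [t]

/-- A tree is a node labelled `o`, whose factors are its children, or it is its only factor. -/
lemma factors_cases (o : AccOp) (t : SynTree A) :
    (∃ c cs, t = node o c cs ∧ factors o t = c :: cs) ∨
      (t.rootOp ≠ some o ∧ factors o t = [t]) := by
  rcases o with _ | _ <;> rcases t with a | ⟨_ | _, c, cs⟩ <;> simp [factors, rootOp]

lemma factors_ne_nil (o : AccOp) (t : SynTree A) : factors o t ≠ [] := by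
  rcases factors_cases o t with ⟨c, cs, rfl, h⟩ | ⟨-, h⟩ <;> simp [h]

lemma forestVars_factors (o : AccOp) (t : SynTree A) : forestVars (factors o t) = t.vars := by
  rcases factors_cases o t with ⟨c, cs, rfl, h⟩ | ⟨-, h⟩ <;> rw [h]
  · exact (vars_node _ _ _).symm
  · exact forestVars_singleton _

lemma forestEdge_factors {o : AccOp} {t : SynTree A} {a b : A} :
    forestEdge o (factors o t) a b ↔ t.edge a b := by
  rcases factors_cases o t with ⟨c, cs, rfl, h⟩ | ⟨-, h⟩ <;> rw [h]
  · exact edge_node.symm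
  · exact forestEdge_singleton

lemma forestValid_factors {o : AccOp} {t : SynTree A} (ht : t.Valid) :
    ForestValid (factors o t) := by
  rcases factors_cases o t with ⟨c, cs, rfl, h⟩ | ⟨-, h⟩ <;> rw [h]
  · exact (valid_node.1 ht).2
  · exact forestValid_singleton.2 ht

lemma factors_normalized {o : AccOp} {t : SynTree A} (ht : t.IsNormalized) :
    ∀ s ∈ factors o t, s.rootOp ≠ some o ∧ s.IsNormalized := by
  rcases factors_cases o t with ⟨c, cs, rfl, h⟩ | ⟨hr, h⟩ <;> rw [h]
  · exact isNormalized_node.1 ht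
  · simpa using ⟨hr, ht⟩

/-- A series cut of a normalized tree falls between two of its factors. -/
lemma exists_factors_eq_append {t : SynTree A} (ht : t.Valid) (hn : t.IsNormalized)
    {U V : Set A} (hUV : t.vars ⊆ U ∪ V) (h : ∀ a ∈ t.vars ∩ U, ∀ b ∈ t.vars ∩ V, t.edge a b) :
    ∃ P S, factors .prior t = P ++ S ∧ forestVars P ⊆ U ∧ forestVars S ⊆ V := by
  have hv := forestValid_factors (o := .prior) ht
  have hasym : ∀ a b, forestEdge .prior (factors .prior t) a b →
      ¬ forestEdge .prior (factors .prior t) b a := by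
    intro a b
    rw [forestEdge_factors, forestEdge_factors]
    exact PExpr.edge_asymm ht.2
  have hr := fun s hs => (factors_normalized (o := .prior) hn s hs).1
  rw [← forestVars_factors .prior] at hUV
  replace h : ∀ a ∈ forestVars (factors .prior t) ∩ U, ∀ b ∈ forestVars (factors .prior t) ∩ V,
      forestEdge .prior (factors .prior t) a b := by
    simpa only [forestEdge_factors, forestVars_factors] using h
  generalize factors .prior t = l at *
  have hpure : ∀ s ∈ l, s.vars ⊆ U ∨ s.vars ⊆ V := by
    intro s hs
    have hsub : s.vars ⊆ forestVars l := fun a ha => mem_forestVars.2 ⟨s, hs, ha⟩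
    refine subset_or_subset_of_not_prior (hv.valid_of_mem hs) (hr s hs) (hsub.trans hUV) ?_
    intro a ha b hb
    exact (forestEdge_iff_of_mem hv hs ha.1 hb.1).1 (h a ⟨hsub ha.1, ha.2⟩ b ⟨hsub hb.1, hb.2⟩)
  clear hUV hr
  induction l with
  | nil => exact ⟨[], [], rfl, by simp [forestVars], by simp [forestVars]⟩
  | cons s l ih =>
    rcases hpure s (by simp) with hs | hs
    · obtain ⟨P, S, rfl, hP, hS⟩ := ih hv.2.2 (fun a b h1 h2 => hasym a b (.inr (.inl h1))
          (.inr (.inl h2))) (fun a ha b hb => by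
          refine ((h a ⟨.inr ha.1, ha.2⟩ b ⟨.inr hb.1, hb.2⟩).resolve_left ?_).resolve_right ?_
          · exact fun hE => Set.disjoint_left.1 hv.2.1 (edge_mem hE).1 ha.1
          · exact fun hE => Set.disjoint_left.1 hv.2.1 hE.2.1 ha.1)
        (fun t ht => hpure t (List.mem_cons_of_mem _ ht))
      exact ⟨s :: P, S, rfl, Set.union_subset hs hP, hS⟩
    · refine ⟨[], s :: l, rfl, by simp [forestVars], Set.union_subset hs ?_⟩
      intro a ha
      obtain ⟨r, hr, har⟩ := mem_forestVars.1 ha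
      refine ((hpure r (List.mem_cons_of_mem _ hr)).resolve_left fun hrU => ?_) har
      obtain ⟨b, hb⟩ := s.vars_nonempty
      exact hasym b a (.inr (.inr ⟨rfl, hb, ha⟩)) (h a ⟨.inr ha, hrU har⟩ b ⟨.inl hb, hs hb⟩)

end SynTree

/-! ### Merging two children of a Pareto node -/

namespace SynTree

variable {A : Type*} {D : A → Type*}

/-- The accumulation of a list of trees by `o` as a tree: there is none for the empty list, and a
single tree stands for itself. -/
def ofForest (o : AccOp) : List (SynTree A) → Option (SynTree A)
  | [] => none
  | [t] => some t
  | t :: s :: ts => some (node o t (s :: ts))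

lemma forestVars_ofForest (o : AccOp) (ts : List (SynTree A)) :
    forestVars (ofForest o ts).toList = forestVars ts := by
  rcases ts with _ | ⟨t, _ | ⟨s, ts⟩⟩
  · rfl
  · rfl
  · exact (forestVars_singleton _).trans (vars_node _ _ _)

/-- As the forest on the left has at most one tree, the operator `o'` does not matter. -/
lemma forestEdge_ofForest {o o' : AccOp} {ts : List (SynTree A)} {a b : A} :
    forestEdge o' (ofForest o ts).toList a b ↔ forestEdge o ts a b := by
  rcases ts with _ | ⟨t, _ | ⟨s, ts⟩⟩
  · exact Iff.rfl
  · exact forestEdge_singleton.trans forestEdge_singleton.symm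
  · exact forestEdge_singleton.trans edge_node

lemma forestValid_ofForest {o : AccOp} {ts : List (SynTree A)} :
    ForestValid (ofForest o ts).toList ↔ ForestValid ts := by
  rcases ts with _ | ⟨t, _ | ⟨s, ts⟩⟩
  · exact Iff.rfl
  · exact Iff.rfl
  · exact forestValid_singleton.trans (valid_node.trans (and_iff_right (List.cons_ne_nil _ _)))

/-- The tree for `((P₁ ⊗ P₂) & (S₁ ⊗ S₂)) ⊗ R`, where `P₁`, `P₂`, `S₁`, `S₂` are read as prioritized
accumulations and `R` as a Pareto accumulation, and empty operands are left out. -/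
def mergeTree (P₁ S₁ P₂ S₂ R : List (SynTree A)) : Option (SynTree A) :=
  ofForest .pareto
    ((ofForest .prior
      ((ofForest .pareto ((ofForest .prior P₁).toList ++ (ofForest .prior P₂).toList)).toList ++
        (ofForest .pareto ((ofForest .prior S₁).toList ++ (ofForest .prior S₂).toList)).toList)
      ).toList ++ (ofForest .pareto R).toList)

lemma forestVars_mergeTree (P₁ S₁ P₂ S₂ R : List (SynTree A)) :
    forestVars (mergeTree P₁ S₁ P₂ S₂ R).toList =
      forestVars (P₁ ++ S₁) ∪ forestVars (P₂ ++ S₂) ∪ forestVars R := by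
  simp only [mergeTree, forestVars_ofForest, forestVars_append]
  ext a
  simp only [Set.mem_union]
  tauto

lemma forestEdge_mergeTree {o : AccOp} {P₁ S₁ P₂ S₂ R : List (SynTree A)} {a b : A} :
    forestEdge o (mergeTree P₁ S₁ P₂ S₂ R).toList a b ↔
      (forestEdge .prior (P₁ ++ S₁) a b ∨ forestEdge .prior (P₂ ++ S₂) a b ∨
        forestEdge .pareto R a b) ∨
      (a ∈ forestVars P₁ ∧ b ∈ forestVars S₂) ∨ (a ∈ forestVars P₂ ∧ b ∈ forestVars S₁) := by
  simp only [mergeTree, forestEdge_ofForest, forestEdge_append, forestVars_ofForest,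
    forestVars_append, reduceCtorEq, false_and, or_false, true_and, Set.mem_union]
  tauto

lemma forestValid_mergeTree {P₁ S₁ P₂ S₂ R : List (SynTree A)} (h₁ : ForestValid (P₁ ++ S₁))
    (h₂ : ForestValid (P₂ ++ S₂)) (hR : ForestValid R)
    (h₁₂ : Disjoint (forestVars (P₁ ++ S₁)) (forestVars (P₂ ++ S₂)))
    (h₁R : Disjoint (forestVars (P₁ ++ S₁)) (forestVars R))
    (h₂R : Disjoint (forestVars (P₂ ++ S₂)) (forestVars R)) :
    ForestValid (mergeTree P₁ S₁ P₂ S₂ R).toList := by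
  simp only [mergeTree, forestValid_ofForest, forestValid_append, forestVars_ofForest,
    forestVars_append, Set.disjoint_union_left, Set.disjoint_union_right] at *
  obtain ⟨_, _, _⟩ := h₁
  obtain ⟨_, _, _⟩ := h₂
  obtain ⟨⟨_, _⟩, _, _⟩ := h₁₂
  obtain ⟨_, _⟩ := h₁R
  obtain ⟨_, _⟩ := h₂R
  and_intros <;> first | assumption | (apply Disjoint.symm; assumption)

lemma exists_mergeTree {P₁ S₁ P₂ S₂ R : List (SynTree A)} (h : P₁ ++ P₂ ≠ []) :
    ∃ y, mergeTree P₁ S₁ P₂ S₂ R = some y := by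
  have ne : ∀ {o : AccOp} {ts : List (SynTree A)}, ts ≠ [] → (ofForest o ts).toList ≠ [] := by
    intro o ts hts
    rcases ts with _ | ⟨t, _ | ⟨s, ts⟩⟩
    exacts [(hts rfl).elim, List.cons_ne_nil _ _, List.cons_ne_nil _ _]
  have : (mergeTree P₁ S₁ P₂ S₂ R).toList ≠ [] := by
    refine ne (List.append_ne_nil_of_left_ne_nil (ne (List.append_ne_nil_of_left_ne_nil
      (ne ?_) _)) _)
    by_cases h' : P₁ = []
    · subst h'
      exact List.append_ne_nil_of_right_ne_nil _ (ne h)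
    · exact List.append_ne_nil_of_left_ne_nil (ne h') _
  exact Option.ne_none_iff_exists'.1 fun h0 => this (by rw [h0]; rfl)

lemma forestVars_perm {l l' : List (SynTree A)} (h : l.Perm l') :
    forestVars l = forestVars l' := by
  ext a
  simp only [mem_forestVars, h.mem_iff]

lemma forestEdge_pareto {l : List (SynTree A)} {a b : A} :
    forestEdge .pareto l a b ↔ ∃ t ∈ l, t.edge a b :=
  ⟨exists_mem_of_forestEdge_pareto, fun ⟨_, ht, h⟩ => forestEdge_of_mem ht h⟩

lemma forestValid_perm {l l' : List (SynTree A)} (h : l.Perm l') :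
    ForestValid l ↔ ForestValid l' := by
  induction h with
  | nil => rfl
  | cons t h ih => simp only [ForestValid, ih, forestVars_perm h]
  | swap s t l =>
    simp only [ForestValid, forestVars, Set.disjoint_union_right, disjoint_comm (a := s.vars)
      (b := t.vars)]
    tauto
  | trans _ _ ih₁ ih₂ => exact ih₁.trans ih₂

/-- `y` arises from the node `t` with label `⊗` by cutting two of its children, read as prioritized
accumulations, into `P₁ & S₁` and `P₂ & S₂` and replacing them by `(P₁ ⊗ P₂) & (S₁ ⊗ S₂)`. The cuts
may be trivial. -/
inductive Merge : SynTree A → SynTree A → Prop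
  | intro {c : SynTree A} {cs l₁ l₂ l₃ l₄ : List (SynTree A)} {t₁ t₂ : SynTree A}
      {P₁ S₁ P₂ S₂ : List (SynTree A)} {y : SynTree A}
      (h₁ : c :: cs = l₁ ++ t₁ :: l₂) (h₂ : l₁ ++ l₂ = l₃ ++ t₂ :: l₄)
      (hf₁ : factors .prior t₁ = P₁ ++ S₁) (hf₂ : factors .prior t₂ = P₂ ++ S₂)
      (hy : mergeTree P₁ S₁ P₂ S₂ (l₃ ++ l₄) = some y) :
      Merge (node .pareto c cs) y

/-- One merge somewhere in the tree. -/
inductive Rewrite : SynTree A → SynTree A → Prop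
  | here {t t' : SynTree A} : Merge t t' → Rewrite t t'
  | child {o : AccOp} {c c' : SynTree A} {cs cs' l₁ l₂ : List (SynTree A)} {t t' : SynTree A}
      (h : c :: cs = l₁ ++ t :: l₂) (h' : c' :: cs' = l₁ ++ t' :: l₂) (ht : Rewrite t t') :
      Rewrite (node o c cs) (node o c' cs')

/-- `(U, V)` is a cut of the tree read as a prioritized accumulation: `U` consists of the attributes
of the first few factors and `V` of the attributes of the others. -/
def IsCut (t : SynTree A) (U V : Set A) : Prop :=
  ∃ P S, factors .prior t = P ++ S ∧ U = forestVars P ∧ V = forestVars S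

/-- `(U, V)` is a cut of a subtree. -/
inductive HasCut : SynTree A → Set A → Set A → Prop
  | here {t : SynTree A} {U V : Set A} : IsCut t U V → HasCut t U V
  | child {o : AccOp} {c : SynTree A} {cs : List (SynTree A)} {t : SynTree A} {U V : Set A}
      (h : t ∈ c :: cs) (ht : HasCut t U V) : HasCut (node o c cs) U V

lemma perm_of_take_two {ts l₁ l₂ l₃ l₄ : List (SynTree A)} {t₁ t₂ : SynTree A}
    (h₁ : ts = l₁ ++ t₁ :: l₂) (h₂ : l₁ ++ l₂ = l₃ ++ t₂ :: l₄) :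
    ts.Perm (t₁ :: t₂ :: (l₃ ++ l₄)) := by
  rw [h₁]
  refine List.perm_middle.trans (.cons _ ?_)
  rw [h₂]
  exact List.perm_middle

/-- The effect of merging on the p-graph: everything in the upper parts is now above everything in
the lower parts. -/
lemma Merge.spec {t y : SynTree A} (ht : t.Valid) (h : Merge t y) :
    y.Valid ∧ y.vars = t.vars ∧ ∃ U₁ V₁ U₂ V₂, HasCut t U₁ V₁ ∧ HasCut t U₂ V₂ ∧
      (∀ a b, y.edge a b ↔ t.edge a b ∨ (a ∈ U₁ ∧ b ∈ V₂) ∨ (a ∈ U₂ ∧ b ∈ V₁)) := by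
  obtain ⟨h₁, h₂, hf₁, hf₂, hy⟩ := h
  rename_i c cs l₁ l₂ l₃ l₄ t₁ t₂ P₁ S₁ P₂ S₂
  have hp := perm_of_take_two h₁ h₂
  obtain ⟨hcs, hv⟩ := valid_node.1 ht
  have hv' := (forestValid_perm hp).1 hv
  simp only [ForestValid, forestVars, Set.disjoint_union_right] at hv'
  obtain ⟨ht₁, ⟨hd₁₂, hd₁⟩, ht₂, hd₂, hR⟩ := hv'
  have hv₁ := forestValid_factors (o := .prior) ht₁
  have hv₂ := forestValid_factors (o := .prior) ht₂
  have hvars₁ := forestVars_factors .prior t₁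
  have hvars₂ := forestVars_factors .prior t₂
  have he₁ := fun a b => forestEdge_factors (o := .prior) (t := t₁) (a := a) (b := b)
  have he₂ := fun a b => forestEdge_factors (o := .prior) (t := t₂) (a := a) (b := b)
  rw [hf₁] at hv₁ hvars₁ he₁
  rw [hf₂] at hv₂ hvars₂ he₂
  have hyl : [y] = (mergeTree P₁ S₁ P₂ S₂ (l₃ ++ l₄)).toList := by rw [hy]; rfl
  refine ⟨?_, ?_, forestVars P₁, forestVars S₁, forestVars P₂, forestVars S₂,
    .child (hp.symm.subset (by simp)) (.here ⟨_, _, hf₁, rfl, rfl⟩),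
    .child (hp.symm.subset (by simp)) (.here ⟨_, _, hf₂, rfl, rfl⟩), ?_⟩
  · rw [← forestValid_singleton, hyl]
    refine forestValid_mergeTree hv₁ hv₂ hR ?_ ?_ ?_ <;> simpa only [hvars₁, hvars₂]
  · rw [← forestVars_singleton, hyl, vars_node, forestVars_mergeTree, forestVars_perm hp, hvars₁,
      hvars₂, Set.union_assoc]
    rfl
  · intro a b
    rw [← forestEdge_singleton (o := .pareto), hyl, edge_node, forestEdge_mergeTree,
      he₁, he₂, forestEdge_pareto, forestEdge_pareto]
    simp only [hp.mem_iff, List.mem_cons, exists_eq_or_imp]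

lemma Rewrite.spec {t y : SynTree A} (ht : t.Valid) (h : Rewrite t y) :
    y.Valid ∧ y.vars = t.vars ∧ ∃ U₁ V₁ U₂ V₂, HasCut t U₁ V₁ ∧ HasCut t U₂ V₂ ∧
      (∀ a b, y.edge a b ↔ t.edge a b ∨ (a ∈ U₁ ∧ b ∈ V₂) ∨ (a ∈ U₂ ∧ b ∈ V₁)) := by
  induction h with
  | here h => exact h.spec ht
  | @child o c c' cs cs' l₁ l₂ t t' h h' _ ih =>
    obtain ⟨hcs, hv⟩ := valid_node.1 ht
    have hm : t ∈ c :: cs := by simp [h]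
    obtain ⟨hy, hvars, U₁, V₁, U₂, V₂, hc₁, hc₂, hE⟩ := ih (hv.valid_of_mem hm)
    refine ⟨valid_node.2 ⟨?_, ?_⟩, ?_, U₁, V₁, U₂, V₂, .child hm hc₁, .child hm hc₂, ?_⟩
    · have e1 := congrArg List.length h
      have e2 := congrArg List.length h'
      have e3 := List.length_pos_iff.2 hcs
      simp only [List.length_cons, List.length_append] at e1 e2
      exact List.length_pos_iff.1 (by omega)
    · rw [h] at hv
      rw [h']
      simp only [forestValid_append, ForestValid, forestVars, hvars] at hv ⊢
      exact ⟨hv.1, ⟨hy, hv.2.1.2⟩, hv.2.2⟩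
    · rw [vars_node, vars_node, h, h']
      simp only [forestVars_append, forestVars, hvars]
    · intro a b
      rw [edge_node, edge_node, h, h']
      simp only [forestEdge_append, forestEdge, forestVars, hvars, hE]
      clear * -
      tauto

/-- Two distinct members of a forest can be taken out one after the other. -/
lemma exists_take_two {ts : List (SynTree A)} {t₁ t₂ : SynTree A} (h₁ : t₁ ∈ ts) (h₂ : t₂ ∈ ts)
    (hne : t₁ ≠ t₂) : ∃ l₁ l₂ l₃ l₄, ts = l₁ ++ t₁ :: l₂ ∧ l₁ ++ l₂ = l₃ ++ t₂ :: l₄ := by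
  obtain ⟨l₁, l₂, rfl⟩ := List.append_of_mem h₁
  have : t₂ ∈ l₁ ++ l₂ := by
    simp only [List.mem_append, List.mem_cons, hne.symm, false_or] at h₂ ⊢
    exact h₂
  obtain ⟨l₃, l₄, h⟩ := List.append_of_mem this
  exact ⟨l₁, l₂, l₃, l₄, rfl, h⟩

/-- If the p-graph of a p-expression properly extends that of a normalized tree, then it contains
the p-graph of a tree that arises by one merge. The merge takes place at a deepest node having a new
edge between two of its children. Restricted to these two children, which are connected, the larger
graph is not parallel, hence it is a series composition, and its cut cuts both children between
factors. -/
theorem exists_rewrite {e : PExpr A} (he : e.IsPSkyline) (t : SynTree A) (ht : t.Valid)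
    (hn : t.IsNormalized) (hvars : t.vars ⊆ e.vars) (hsub : ∀ a b, t.edge a b → e.edge a b)
    (hnew : ∃ a ∈ t.vars, ∃ b ∈ t.vars, e.edge a b ∧ ¬ t.edge a b) :
    ∃ t', Rewrite t t' ∧ (∀ a b, t'.edge a b → e.edge a b) ∧ ∃ a b, t'.edge a b ∧ ¬ t.edge a b := by
  induction t using inductionOn with
  | leaf c =>
    obtain ⟨a, ha, b, hb, hE, -⟩ := hnew
    rw [vars_leaf] at ha hb
    exact (PExpr.ne_of_edge he hE (Eq.trans ha (Eq.symm hb))).elim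
  | node o c cs ih =>
    obtain ⟨hcs, hv⟩ := valid_node.1 ht
    have hmem : ∀ s ∈ c :: cs, s.vars ⊆ (node o c cs).vars := fun s hs a ha => by
      rw [vars_node]; exact mem_forestVars.2 ⟨s, hs, ha⟩
    have hsub' : ∀ s ∈ c :: cs, ∀ a b, s.edge a b → e.edge a b := fun s hs a b h =>
      hsub a b (edge_node.2 (forestEdge_of_mem hs h))
    have hns := isNormalized_node.1 hn
    by_cases hch : ∃ s ∈ c :: cs, ∃ a ∈ s.vars, ∃ b ∈ s.vars, e.edge a b ∧ ¬ s.edge a b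
    · obtain ⟨s, hs, hnew⟩ := hch
      obtain ⟨s', hss', hs', x, z, hxz, hxz'⟩ := ih s hs (hv.valid_of_mem hs) (hns s hs).2
        ((hmem s hs).trans hvars) (hsub' s hs) hnew
      obtain ⟨l₁, l₂, hl⟩ := List.append_of_mem hs
      obtain ⟨c', cs', hl'⟩ : ∃ c' cs', c' :: cs' = l₁ ++ s' :: l₂ := by
        cases l₁ <;> exact ⟨_, _, rfl⟩
      have hrw : Rewrite (node o c cs) (node o c' cs') := .child hl hl' hss'
      have hsvars := (hss'.spec (hv.valid_of_mem hs)).2.1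
      refine ⟨_, hrw, fun a b => ?_, x, z, ?_, ?_⟩
      rotate_left
      · rw [edge_node, hl']
        exact forestEdge_of_mem (by simp) hxz
      · rw [edge_node, forestEdge_iff_of_mem hv hs (hsvars ▸ (edge_mem hxz).1)
          (hsvars ▸ (edge_mem hxz).2)]
        exact hxz'
      have := hsub a b
      rw [edge_node, hl] at this
      rw [edge_node, hl']
      simp only [forestEdge_append, forestEdge, forestVars, hsvars] at this ⊢
      have := hs' a b
      tauto
    · push Not at hch
      obtain ⟨a, ha, b, hb, hE, hE'⟩ := hnew
      rw [vars_node] at ha hb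
      obtain ⟨t₁, h₁, ha⟩ := mem_forestVars.1 ha
      obtain ⟨t₂, h₂, hb⟩ := mem_forestVars.1 hb
      have hne : t₁ ≠ t₂ := by
        rintro rfl
        exact hE' (edge_node.2 (forestEdge_of_mem h₁ (hch t₁ h₁ a ha b hb hE)))
      cases o with
      | prior =>
        rw [edge_node] at hE'
        have := (forestEdge_prior_of_ne h₁ h₂ hne ha hb).resolve_left hE'
        exact (PExpr.edge_asymm he hE (hsub _ _ (edge_node.2 this))).elim
      | pareto =>
        have hW : t₁.vars ∪ t₂.vars ⊆ e.vars :=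
          (Set.union_subset (hmem _ h₁) (hmem _ h₂)).trans hvars
        obtain ⟨U, V, hU, hV, hd, hUV, h⟩ := PExpr.exists_series_or_parallel he hW
          ⟨a, .inl ha, b, .inr hb, PExpr.ne_of_edge he hE⟩
        have hs₁ : t₁.vars ⊆ U ∪ V := hUV ▸ Set.subset_union_left
        have hs₂ : t₂.vars ⊆ U ∪ V := hUV ▸ Set.subset_union_right
        have hv₁ := hv.valid_of_mem h₁
        have hv₂ := hv.valid_of_mem h₂
        rcases h with h | h
        · obtain ⟨P₁, S₁, hf₁, hP₁, hS₁⟩ := exists_factors_eq_append hv₁ (hns _ h₁).2 hs₁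
            fun a ha b hb => hch t₁ h₁ a ha.1 b hb.1 (h a ha.2 b hb.2)
          obtain ⟨P₂, S₂, hf₂, hP₂, hS₂⟩ := exists_factors_eq_append hv₂ (hns _ h₂).2 hs₂
            fun a ha b hb => hch t₂ h₂ a ha.1 b hb.1 (h a ha.2 b hb.2)
          have hUVd : ∀ a ∈ U, a ∉ V := fun a ha => Set.disjoint_left.1 hd ha
          have hcov : U ∪ V = forestVars (P₁ ++ P₂) ∪ forestVars (S₁ ++ S₂) := by
            rw [hUV, ← forestVars_factors .prior t₁, ← forestVars_factors .prior t₂, hf₁, hf₂]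
            simp only [forestVars_append]
            ext a
            simp only [Set.mem_union]
            tauto
          have hP : P₁ ++ P₂ ≠ [] := by
            intro h0
            obtain ⟨x, hx⟩ := hU
            have : x ∈ forestVars (P₁ ++ P₂) ∪ forestVars (S₁ ++ S₂) := hcov ▸ Or.inl hx
            rw [h0, forestVars_append] at this
            rcases this with h' | h' | h'
            exacts [h', hUVd x hx (hS₁ h'), hUVd x hx (hS₂ h')]
          have hS : S₁ ++ S₂ ≠ [] := by
            intro h0
            obtain ⟨x, hx⟩ := hV
            have : x ∈ forestVars (P₁ ++ P₂) ∪ forestVars (S₁ ++ S₂) := hcov ▸ Or.inr hx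
            rw [h0, forestVars_append] at this
            rcases this with (h' | h') | h'
            exacts [hUVd x (hP₁ h') hx, hUVd x (hP₂ h') hx, h']
          obtain ⟨l₁, l₂, l₃, l₄, hl₁, hl₂⟩ := exists_take_two h₁ h₂ hne
          obtain ⟨y, hy⟩ := exists_mergeTree (S₁ := S₁) (S₂ := S₂) (R := l₃ ++ l₄) hP
          refine ⟨y, .here (.intro hl₁ hl₂ hf₁ hf₂ hy), fun x z hxz => ?_, ?_⟩
          all_goals have hyl : (mergeTree P₁ S₁ P₂ S₂ (l₃ ++ l₄)).toList = [y] := by rw [hy]; rfl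
          rotate_left
          · have hcross : (P₁ ≠ [] ∧ S₂ ≠ []) ∨ (P₂ ≠ [] ∧ S₁ ≠ []) := by
              have hf₁' : factors .prior t₁ ≠ [] := factors_ne_nil _ _
              have hf₂' : factors .prior t₂ ≠ [] := factors_ne_nil _ _
              rw [hf₁] at hf₁'
              rw [hf₂] at hf₂'
              simp only [ne_eq, List.append_eq_nil_iff] at hP hS hf₁' hf₂' ⊢
              tauto
            have cross : ∀ x ∈ t₁.vars, ∀ z ∈ t₂.vars, ¬ (node .pareto c cs).edge x z ∧
                ¬ (node .pareto c cs).edge z x := by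
              intro x hx z hz
              rw [edge_node, edge_node, forestEdge_pareto, forestEdge_pareto]
              constructor
              all_goals
                rintro ⟨s, hs, hsE⟩
                have := edge_mem hsE
                refine hne ((eq_of_mem_vars hv h₁ hs hx ?_).trans
                  (eq_of_mem_vars hv hs h₂ ?_ hz))
              exacts [this.1, this.2, this.2, this.1]
            rw [← forestVars_factors .prior, hf₁, forestVars_append] at cross
            rw [← forestVars_factors .prior t₂, hf₂, forestVars_append] at cross
            simp only [← forestEdge_singleton (o := .pareto) (t := y), ← hyl,
              forestEdge_mergeTree]
            rcases hcross with ⟨hx, hz⟩ | ⟨hx, hz⟩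
            · obtain ⟨x, hx⟩ := forestVars_nonempty hx
              obtain ⟨z, hz⟩ := forestVars_nonempty hz
              exact ⟨x, z, .inr (.inl ⟨hx, hz⟩), (cross x (.inl hx) z (.inr hz)).1⟩
            · obtain ⟨x, hx⟩ := forestVars_nonempty hx
              obtain ⟨z, hz⟩ := forestVars_nonempty hz
              exact ⟨x, z, .inr (.inr ⟨hx, hz⟩), (cross z (.inr hz) x (.inl hx)).2⟩
          rw [← forestEdge_singleton (o := .pareto), ← hyl, forestEdge_mergeTree, ← hf₁, ← hf₂,
            forestEdge_factors, forestEdge_factors, forestEdge_pareto] at hxz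
          rcases hxz with (hxz | hxz | ⟨s, hs, hxz⟩) | ⟨hx, hz⟩ | ⟨hx, hz⟩
          · exact hsub' _ h₁ _ _ hxz
          · exact hsub' _ h₂ _ _ hxz
          · exact hsub' s ((perm_of_take_two hl₁ hl₂).symm.subset (by simp [List.mem_append.1 hs]))
              _ _ hxz
          · exact h x (hP₁ hx) z (hS₂ hz)
          · exact h x (hP₂ hx) z (hS₁ hz)
        · exfalso
          have c₁ := subset_or_subset_of_not_pareto hv₁ (hns _ h₁).1 hs₁ fun a ha b hb =>
            (h a ha.2 b hb.2).imp (mt (hsub' _ h₁ _ _)) (mt (hsub' _ h₁ _ _))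
          have c₂ := subset_or_subset_of_not_pareto hv₂ (hns _ h₂).1 hs₂ fun a ha b hb =>
            (h a ha.2 b hb.2).imp (mt (hsub' _ h₂ _ _)) (mt (hsub' _ h₂ _ _))
          -- So each child lies on one side. On different sides they have no edge in common, and
          -- on the same side they leave the other side empty.
          rcases c₁ with c₁ | c₁ <;> rcases c₂ with c₂ | c₂
          · obtain ⟨x, hx⟩ := hV
            exact Set.disjoint_left.1 hd ((hUV ▸ Set.union_subset c₁ c₂ : U ∪ V ⊆ U) (.inr hx)) hx
          · exact (h a (c₁ ha) b (c₂ hb)).1 hE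
          · exact (h b (c₂ hb) a (c₁ ha)).2 hE
          · obtain ⟨x, hx⟩ := hU
            exact Set.disjoint_left.1 hd hx ((hUV ▸ Set.union_subset c₁ c₂ : U ∪ V ⊆ V) (.inl hx))

end SynTree

/-! ### Counting minimal p-extensions -/

namespace SynTree

variable {A : Type*} {D : A → Type*}

/-- Every p-expression without repeated attributes has a normalized syntax tree. -/
lemma exists_normalized {e : PExpr A} (he : e.IsPSkyline) : ∃ t : SynTree A,
    t.Valid ∧ t.IsNormalized ∧ t.vars = e.vars ∧ ∀ a b, t.edge a b ↔ e.edge a b := by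
  induction e with
  | atom c => exact ⟨leaf c, valid_leaf c, by simp [IsNormalized], vars_leaf c, fun _ _ => Iff.rfl⟩
  | acc o l r ihl ihr =>
    obtain ⟨hd, hl, hr⟩ := he
    obtain ⟨t, ht, htn, htv, hte⟩ := ihl hl
    obtain ⟨s, hs, hsn, hsv, hse⟩ := ihr hr
    obtain ⟨c, ts, h₁⟩ := List.exists_cons_of_ne_nil (factors_ne_nil o t)
    have hf : factors o t ++ factors o s = c :: (ts ++ factors o s) := by simp [h₁]
    refine ⟨node o c (ts ++ factors o s), valid_node.2 ⟨?_, ?_⟩, isNormalized_node.2 ?_, ?_, ?_⟩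
    · simp [factors_ne_nil]
    · rw [← hf, forestValid_append, forestVars_factors, forestVars_factors, htv, hsv]
      exact ⟨forestValid_factors ht, forestValid_factors hs, hd⟩
    · rw [← hf]
      intro x hx
      exact (List.mem_append.1 hx).elim (factors_normalized htn x) (factors_normalized hsn x)
    · rw [vars_node, ← hf, forestVars_append, forestVars_factors, forestVars_factors, htv, hsv]
      rfl
    · intro a b
      rw [edge_node, ← hf, forestEdge_append, forestEdge_factors, forestEdge_factors,
        forestVars_factors, forestVars_factors, htv, hsv, hte, hse]
      rfl

/-- There are linearly many cuts: a node with `n` children has at most `n + 1` cuts, and the number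
of nodes is linear in the number of leaves. -/
lemma exists_list_hasCut [Finite A] (t : SynTree A) (ht : t.Valid) :
    ∃ L : List (Set A × Set A), L.length + 3 ≤ 5 * t.vars.ncard ∧
      ∀ U V, HasCut t U V → (U, V) ∈ L := by
  -- The cuts at the root.
  have root : ∀ t : SynTree A, ∃ L : List (Set A × Set A),
      L.length = (factors .prior t).length + 1 ∧ ∀ U V, IsCut t U V → (U, V) ∈ L := by
    intro t
    refine ⟨(List.range ((factors .prior t).length + 1)).map fun i =>
      (forestVars ((factors .prior t).take i), forestVars ((factors .prior t).drop i)), by simp, ?_⟩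
    rintro U V ⟨P, S, h, rfl, rfl⟩
    refine List.mem_map.2 ⟨P.length, ?_, ?_⟩
    · rw [h, List.mem_range, List.length_append]
      omega
    · rw [h]
      simp
  induction t using inductionOn with
  | leaf c =>
    obtain ⟨L, hL, h⟩ := root (leaf c)
    refine ⟨L, by simp [hL, factors, vars_leaf], fun U V hUV => ?_⟩
    cases hUV with
    | here h' => exact h U V h'
  | node o c cs ih =>
    obtain ⟨hcs, hv⟩ := valid_node.1 ht
    have forest : ∀ ts : List (SynTree A), ForestValid ts → (∀ t ∈ ts, t ∈ c :: cs) →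
        ∃ L : List (Set A × Set A), L.length + 3 * ts.length ≤ 5 * (forestVars ts).ncard ∧
          ∀ t ∈ ts, ∀ U V, HasCut t U V → (U, V) ∈ L := by
      intro ts hts hsub
      induction ts with
      | nil => exact ⟨[], by simp, by simp⟩
      | cons t ts ih' =>
        obtain ⟨L₁, hL₁, h₁⟩ := ih t (hsub t (by simp)) hts.1
        obtain ⟨L₂, hL₂, h₂⟩ := ih' hts.2.2 fun s hs => hsub s (List.mem_cons_of_mem _ hs)
        refine ⟨L₁ ++ L₂, ?_, ?_⟩
        · rw [forestVars, Set.ncard_union_eq hts.2.1 (Set.toFinite _) (Set.toFinite _)]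
          simp only [List.length_append, List.length_cons]
          omega
        · rintro s hs U V hUV
          rcases List.mem_cons.1 hs with rfl | hs
          · exact List.mem_append_left _ (h₁ U V hUV)
          · exact List.mem_append_right _ (h₂ s hs U V hUV)
    obtain ⟨L₁, hL₁, h₁⟩ := root (node o c cs)
    obtain ⟨L₂, hL₂, h₂⟩ := forest (c :: cs) hv fun _ => id
    refine ⟨L₁ ++ L₂, ?_, fun U V hUV => ?_⟩
    · have := List.length_pos_iff.2 hcs
      have hf : (factors .prior (node o c cs)).length ≤ (c :: cs).length := by
        cases o <;> simp [factors]
      rw [vars_node]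
      simp only [List.length_append, List.length_cons] at *
      omega
    · cases hUV with
      | here h' => exact List.mem_append_left _ (h₁ U V h')
      | child ht h' => exact List.mem_append_right _ (h₂ _ ht U V h')

variable (gt : ∀ a, D a → D a → Prop) [∀ a, IsStrictTotalOrder (D a) (gt a)]
  [∀ a, Infinite (D a)]

/-- Every minimal p-extension arises by one merge in a normalized syntax tree. -/
theorem exists_rewrite_of_mem_minPExtensions {t : SynTree A} (ht : t.Valid) (hn : t.IsNormalized)
    (hu : t.vars = Set.univ) {R' : Set ((∀ a, D a) × (∀ a, D a))}
    (hR' : R' ∈ minPExtensions gt (t.toExpr.rel gt)) :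
    ∃ t', Rewrite t t' ∧ t'.IsSyntaxTreeOf gt R' := by
  obtain ⟨⟨⟨e, he, rfl⟩, hss⟩, hmin⟩ := hR'
  have hft : t.toExpr.IsFull := ⟨ht.2, hu⟩
  have hsub := (PExpr.rel_subset_iff gt hft he).1 hss.subset
  have hnew : ∃ a b, e.edge a b ∧ ¬ t.edge a b := by
    by_contra! h
    exact hss.not_subset ((PExpr.rel_subset_iff gt he hft).2 h)
  obtain ⟨a, b, hE, hE'⟩ := hnew
  obtain ⟨t', hr, ht', x, z, hxz, hxz'⟩ := exists_rewrite he.1 t ht hn (by simp [he.2]) hsub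
    ⟨a, hu ▸ trivial, b, hu ▸ trivial, hE, hE'⟩
  obtain ⟨hv, hvars, U₁, V₁, U₂, V₂, -, -, hedge⟩ := hr.spec ht
  have hf' : t'.toExpr.IsFull := ⟨hv.2, hvars.trans hu⟩
  refine ⟨t', hr, hv.1, hf', ?_⟩
  have h1 : t'.toExpr.rel gt ⊆ e.rel gt := (PExpr.rel_subset_iff gt hf' he).2 ht'
  by_contra hne
  refine hmin ⟨_, ⟨t'.toExpr, hf', rfl⟩, ⟨?_, fun h => ?_⟩, h1.ssubset_of_ne hne⟩
  · exact (PExpr.rel_subset_iff gt hft hf').2 fun a b h => (hedge a b).2 (.inl h)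
  · exact hxz' ((PExpr.rel_subset_iff gt hf' hft).1 h x z hxz)

end SynTree

/-- There are at most quadratically many minimal p-extensions, as each is determined by two cuts
in a normalized syntax tree. -/
theorem ncard_minPExtensions_le {A : Type*} [Fintype A] {D : A → Type*} [∀ a, Infinite (D a)]
    (gt : ∀ a, D a → D a → Prop) [∀ a, IsStrictTotalOrder (D a) (gt a)]
    {R : Set ((∀ a, D a) × (∀ a, D a))} (hR : R ∈ fullPSkyline gt) :
    (minPExtensions gt R).ncard ≤ 25 * Fintype.card A ^ 2 := by
  classical
  obtain ⟨e, he, rfl⟩ := hR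
  obtain ⟨t, ht, hn, hvars, hedge⟩ := SynTree.exists_normalized he.1
  have hu : t.vars = Set.univ := hvars.trans he.2
  have hrel : e.rel gt = t.toExpr.rel gt := by
    rw [PExpr.rel_eq_graphRel gt he, PExpr.rel_eq_graphRel gt ⟨ht.2, hu⟩]
    exact congrArg _ (funext₂ fun a b => propext (hedge a b).symm)
  obtain ⟨L, hL, hcut⟩ := t.exists_list_hasCut ht
  rw [hu, Set.ncard_univ, Nat.card_eq_fintype_card] at hL
  let f : (Set A × Set A) × (Set A × Set A) → Set ((∀ a, D a) × (∀ a, D a)) := fun p =>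
    PExpr.graphRel gt fun a b => t.edge a b ∨ (a ∈ p.1.1 ∧ b ∈ p.2.2) ∨ (a ∈ p.2.1 ∧ b ∈ p.1.2)
  have hsub : minPExtensions gt (e.rel gt) ⊆ ((L.toFinset ×ˢ L.toFinset).image f : Finset _) := by
    intro R' hR'
    rw [hrel] at hR'
    obtain ⟨t', hr, -, hf', rfl⟩ := SynTree.exists_rewrite_of_mem_minPExtensions gt ht hn hu hR'
    obtain ⟨-, -, U₁, V₁, U₂, V₂, h₁, h₂, hE⟩ := hr.spec ht
    refine Finset.mem_coe.2 (Finset.mem_image.2 ⟨((U₁, V₁), (U₂, V₂)), ?_, ?_⟩)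
    · simpa using ⟨hcut _ _ h₁, hcut _ _ h₂⟩
    · rw [PExpr.rel_eq_graphRel gt hf']
      exact congrArg (PExpr.graphRel gt) (funext₂ fun a b => propext (hE a b).symm)
  calc (minPExtensions gt (e.rel gt)).ncard
      ≤ ((L.toFinset ×ˢ L.toFinset).image f).card := by
        rw [← Set.ncard_coe_finset]
        exact Set.ncard_le_ncard hsub (Finset.finite_toSet _)
    _ ≤ L.toFinset.card * L.toFinset.card := by
        rw [← Finset.card_product]
        exact Finset.card_image_le
    _ ≤ (5 * Fintype.card A) * (5 * Fintype.card A) := by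
        have := L.toFinset_card_le
        exact Nat.mul_le_mul (by omega) (by omega)
    _ = 25 * Fintype.card A ^ 2 := by ring

/-! ### All p-extensions of the skyline relation -/

namespace PExpr

variable {A : Type*} {D : A → Type*}

/-- The accumulation of a nonempty list of attributes by `o`. -/
def ofAttrs (o : AccOp) : A → List A → PExpr A
  | a, [] => atom a
  | a, b :: l => acc o (atom a) (ofAttrs o b l)

lemma vars_ofAttrs (o : AccOp) (a : A) (l : List A) :
    (ofAttrs o a l).vars = {c | c ∈ a :: l} := by
  induction l generalizing a with
  | nil => ext; simp [ofAttrs, vars]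
  | cons b l ih => ext; simp [ofAttrs, vars, ih]

lemma isPSkyline_ofAttrs {o : AccOp} {a : A} {l : List A} (h : (a :: l).Nodup) :
    (ofAttrs o a l).IsPSkyline := by
  induction l generalizing a with
  | nil => trivial
  | cons b l ih =>
    rw [List.nodup_cons] at h
    refine ⟨?_, trivial, ih h.2⟩
    rw [vars_ofAttrs, vars, Set.disjoint_singleton_left]
    exact h.1

lemma onlyPareto_ofAttrs (a : A) (l : List A) : (ofAttrs .pareto a l).OnlyPareto := by
  induction l generalizing a with
  | nil => trivial
  | cons b l ih => exact ⟨rfl, trivial, ih b⟩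

lemma not_edge_of_onlyPareto {e : PExpr A} (h : e.OnlyPareto) (a b : A) : ¬ e.edge a b := by
  induction e with
  | atom c => exact id
  | acc o l r ihl ihr =>
    obtain ⟨rfl, hl, hr⟩ := h
    simp [edge, ihl hl, ihr hr]

/-- The prioritized accumulation of attributes listed in increasing order induces this order. -/
lemma edge_ofAttrs_prior {ι : Type*} [LinearOrder ι] (f : A → ι) {a : A} {l : List A}
    (h : (a :: l).Pairwise fun x y => f x < f y) {x y : A} (hx : x ∈ a :: l) (hy : y ∈ a :: l) :
    (ofAttrs .prior a l).edge x y ↔ f x < f y := by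
  induction l generalizing a with
  | nil =>
    rw [List.mem_singleton] at hx hy
    simp [hx, hy, ofAttrs, edge]
  | cons b l ih =>
    obtain ⟨ha, h'⟩ := List.pairwise_cons.1 h
    simp only [ofAttrs, edge, false_or, vars, Set.mem_singleton_iff, true_and, vars_ofAttrs]
    have hnot : a ∉ b :: l := fun hm => lt_irrefl _ (ha a hm)
    rcases List.mem_cons.1 hx with hx | hx
    · subst hx
      rcases List.mem_cons.1 hy with hy | hy
      · subst hy
        have : ¬ (ofAttrs .prior b l).edge y y := fun hE => hnot (by
          have := (edge_mem hE).1
          rwa [vars_ofAttrs] at this)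
        simp only [this, false_or, lt_irrefl, iff_false, not_and]
        exact fun _ => hnot
      · exact iff_of_true (.inr ⟨rfl, hy⟩) (ha y hy)
    · rcases List.mem_cons.1 hy with hy | hy
      · rw [hy]
        refine iff_of_false ?_ (ha x hx).le.not_gt
        rintro (hE | ⟨-, hE⟩)
        · have := (edge_mem hE).2
          rw [vars_ofAttrs] at this
          exact hnot this
        · exact hnot hE
      · rw [ih h' hx hy]
        refine or_iff_left ?_
        rintro ⟨h, -⟩
        exact hnot (h ▸ hx)

/-- Every ordering of the attributes is the p-graph of a full p-skyline relation. -/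
lemma exists_edge_iff_lt [Fintype A] [Nonempty A] (σ : A ≃ Fin (Fintype.card A)) :
    ∃ e : PExpr A, e.IsFull ∧ ∀ a b, e.edge a b ↔ σ a < σ b := by
  have hne : (List.finRange (Fintype.card A)).map σ.symm ≠ [] := by
    simp [Fintype.card_ne_zero]
  obtain ⟨a, l, hal⟩ := List.exists_cons_of_ne_nil hne
  have hmem : ∀ x, x ∈ a :: l := fun x => by
    rw [← hal, List.mem_map]
    exact ⟨σ x, List.mem_finRange _, by simp⟩
  have hp : (a :: l).Pairwise fun x y => σ x < σ y := by
    rw [← hal, List.pairwise_map]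
    simpa using List.pairwise_lt_finRange _
  refine ⟨ofAttrs .prior a l, ⟨isPSkyline_ofAttrs ?_, ?_⟩, fun x y =>
    edge_ofAttrs_prior σ hp (hmem x) (hmem y)⟩
  · exact hp.imp fun h h' => (h' ▸ h).false
  · rw [vars_ofAttrs]
    exact Set.eq_univ_of_forall hmem

end PExpr

lemma exists_isSkylineRel {A : Type*} [Fintype A] [Nonempty A] {D : A → Type*}
    (gt : ∀ a, D a → D a → Prop) : ∃ R, IsSkylineRel gt R := by
  obtain ⟨a, l, hal⟩ := List.exists_cons_of_ne_nil
    (l := (Finset.univ : Finset A).toList) (by simp [Finset.univ_nonempty.ne_empty])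
  have hmem : ∀ x, x ∈ a :: l := fun x => by simp [← hal]
  have hnd : (a :: l).Nodup := hal ▸ Finset.nodup_toList _
  refine ⟨_, PExpr.ofAttrs .pareto a l, ⟨PExpr.isPSkyline_ofAttrs hnd, ?_⟩,
    PExpr.onlyPareto_ofAttrs a l, rfl⟩
  rw [PExpr.vars_ofAttrs]
  exact Set.eq_univ_of_forall hmem

/-- The orderings of the attributes give different p-extensions of the skyline relation. -/
theorem factorial_le_ncard_pExtensions {A : Type*} [Fintype A] {D : A → Type*}
    [∀ a, Infinite (D a)] (gt : ∀ a, D a → D a → Prop) [∀ a, IsStrictTotalOrder (D a) (gt a)]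
    (hA : 2 ≤ Fintype.card A) {R : Set ((∀ a, D a) × (∀ a, D a))} (hR : IsSkylineRel gt R) :
    (Fintype.card A).factorial ≤ (pExtensions gt R).ncard := by
  classical
  have : Nontrivial A := Fintype.one_lt_card_iff_nontrivial.1 hA
  obtain ⟨e, he, hp, rfl⟩ := hR
  choose f hf hlt using PExpr.exists_edge_iff_lt (A := A)
  have hinj : Function.Injective fun σ => (f σ).rel gt := by
    intro σ τ h
    have hlt' : ∀ a b, σ a < σ b ↔ τ a < τ b := by
      intro a b
      rw [← hlt, ← hlt]
      exact ⟨(PExpr.rel_subset_iff gt (hf σ) (hf τ)).1 h.subset a b,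
        (PExpr.rel_subset_iff gt (hf τ) (hf σ)).1 h.superset a b⟩
    -- The composition is an order automorphism of `Fin n`.
    let ρ : Fin (Fintype.card A) ≃o Fin (Fintype.card A) :=
      { toEquiv := σ.symm.trans τ
        map_rel_iff' := by
          intro i j
          rw [← not_lt, ← not_lt, not_iff_not]
          simp [← hlt'] }
    have hρ : ρ = OrderIso.refl _ := Subsingleton.elim _ _
    ext1 a
    have := congrArg (fun g : Fin (Fintype.card A) ≃o Fin (Fintype.card A) => g (σ a)) hρ
    simpa [ρ] using this.symm
  have hsub : Set.range (fun σ => (f σ).rel gt) ⊆ pExtensions gt (e.rel gt) := by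
    rintro _ ⟨σ, rfl⟩
    refine ⟨⟨f σ, hf σ, rfl⟩, (PExpr.rel_subset_iff gt he (hf σ)).2 fun a b h =>
      (PExpr.not_edge_of_onlyPareto hp a b h).elim, fun h => ?_⟩
    obtain ⟨a, b, hab⟩ := exists_pair_ne A
    have := (PExpr.rel_subset_iff gt (hf σ) he).1 h
    rcases lt_or_gt_of_ne (σ.injective.ne hab) with h' | h'
    · exact PExpr.not_edge_of_onlyPareto hp a b (this a b ((hlt σ a b).2 h'))
    · exact PExpr.not_edge_of_onlyPareto hp b a (this b a ((hlt σ b a).2 h'))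
  calc (Fintype.card A).factorial = Nat.card (A ≃ Fin (Fintype.card A)) := by
        rw [Nat.card_eq_fintype_card, Fintype.card_equiv (Fintype.equivFin A)]
    _ = (Set.range fun σ => (f σ).rel gt).ncard := by
        rw [← Set.image_univ, Set.ncard_image_of_injective _ hinj, Set.ncard_univ]
    _ ≤ _ := Set.ncard_le_ncard hsub
        ((finite_fullPSkyline gt).subset fun _ h => h.1)

/-! ### Trees and forests in memory -/

namespace SynTree

variable {A : Type*} {m m' : ℕ → ℕ} {code : A → ℕ}

/-- The memory holds the tree `t` at address `p`, without overlaps, on the set `S` of positive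
addresses. -/
def TreeAt (m : ℕ → ℕ) (code : A → ℕ) (t : SynTree A) (p : ℕ) (S : Set ℕ) : Prop :=
  ∃ l : List ℕ, StoredAt m code t p l ∧ l.Nodup ∧ (∀ x ∈ l, 0 < x) ∧ S = {x | x ∈ l}

/-- The memory holds the list `ts` of trees at address `q`, without overlaps, on the set `S` of
positive addresses. -/
def ForestAt (m : ℕ → ℕ) (code : A → ℕ) (ts : List (SynTree A)) (q : ℕ) (S : Set ℕ) : Prop :=
  ∃ l : List ℕ, ListStoredAt m code ts q l ∧ l.Nodup ∧ (∀ x ∈ l, 0 < x) ∧ S = {x | x ∈ l}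

lemma treeAt_leaf {a : A} {p : ℕ} {S : Set ℕ} : TreeAt m code (leaf a) p S ↔
    m p = 0 ∧ m (p + 1) = code a ∧ p ≠ 0 ∧ S = {p, p + 1} := by
  constructor
  · rintro ⟨l, ⟨h₁, h₂, rfl⟩, -, hpos, rfl⟩
    exact ⟨h₁, h₂, (hpos p (by simp)).ne', by ext; simp⟩
  · rintro ⟨h₁, h₂, hp, rfl⟩
    refine ⟨[p, p + 1], ⟨h₁, h₂, rfl⟩, by simp, ?_, by ext; simp⟩
    intro x hx
    simp only [List.mem_cons, List.not_mem_nil, or_false] at hx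
    omega

lemma forestAt_nil {q : ℕ} {S : Set ℕ} :
    ForestAt m code [] q S ↔ q = 0 ∧ S = ∅ := by
  constructor
  · rintro ⟨l, ⟨h₁, rfl⟩, -, -, rfl⟩
    exact ⟨h₁, by ext; simp⟩
  · rintro ⟨h₁, rfl⟩
    exact ⟨[], ⟨h₁, rfl⟩, by simp, by simp, by ext; simp⟩

lemma forestAt_cons {t : SynTree A} {ts : List (SynTree A)} {q : ℕ} {S : Set ℕ} :
    ForestAt m code (t :: ts) q S ↔ q ≠ 0 ∧ ∃ S₁ S₂, TreeAt m code t (m q) S₁ ∧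
      ForestAt m code ts (m (q + 1)) S₂ ∧ Disjoint S₁ S₂ ∧ (q ∉ S₁ ∧ q + 1 ∉ S₁) ∧
      (q ∉ S₂ ∧ q + 1 ∉ S₂) ∧ S = {q, q + 1} ∪ (S₁ ∪ S₂) := by
  constructor
  · rintro ⟨l, ⟨hq, l₁, l₂, h₁, h₂, rfl⟩, hnd, hpos, rfl⟩
    simp only [List.nodup_cons, List.mem_cons, List.mem_append, not_or,
      List.nodup_append] at hnd
    obtain ⟨⟨-, hq₁, hq₂⟩, ⟨hq₁', hq₂'⟩, hn₁, hn₂, hd⟩ := hnd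
    refine ⟨hq, _, _, ⟨l₁, h₁, hn₁, fun x hx => hpos x (by simp [hx]), rfl⟩,
      ⟨l₂, h₂, hn₂, fun x hx => hpos x (by simp [hx]), rfl⟩, ?_, ⟨hq₁, hq₁'⟩, ⟨hq₂, hq₂'⟩, ?_⟩
    · exact Set.disjoint_left.2 fun x hx hx' => hd x hx x hx' rfl
    · ext x
      simp [or_assoc]
  · rintro ⟨hq, _, _, ⟨l₁, h₁, hn₁, hpos₁, rfl⟩, ⟨l₂, h₂, hn₂, hpos₂, rfl⟩, hd, ⟨hq₁, hq₁'⟩,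
      ⟨hq₂, hq₂'⟩, rfl⟩
    refine ⟨q :: (q + 1) :: (l₁ ++ l₂), ⟨hq, l₁, l₂, h₁, h₂, rfl⟩, ?_, ?_, ?_⟩
    · simp only [List.nodup_cons, List.mem_cons, List.mem_append, not_or,
        List.nodup_append]
      refine ⟨⟨by omega, hq₁, hq₂⟩, ⟨hq₁', hq₂'⟩, hn₁, hn₂, ?_⟩
      rintro x hx y hy rfl
      exact Set.disjoint_left.1 hd hx hy
    · intro x hx
      simp only [List.mem_cons, List.mem_append] at hx
      rcases hx with rfl | rfl | hx | hx
      exacts [by omega, by omega, hpos₁ x hx, hpos₂ x hx]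
    · ext x
      simp [or_assoc]

lemma treeAt_node {o : AccOp} {c : SynTree A} {cs : List (SynTree A)} {p : ℕ} {S : Set ℕ} :
    TreeAt m code (node o c cs) p S ↔ m p = o.tag ∧ p ≠ 0 ∧ ∃ S',
      ForestAt m code (c :: cs) (m (p + 1)) S' ∧ p ∉ S' ∧ p + 1 ∉ S' ∧ S = {p, p + 1} ∪ S' := by
  constructor
  · rintro ⟨l, ⟨h, hq, l₁, l₂, h₁, h₂, rfl⟩, hnd, hpos, rfl⟩
    rw [List.nodup_cons, List.nodup_cons] at hnd
    refine ⟨h, (hpos p (by simp)).ne', _, ⟨_, ⟨hq, l₁, l₂, h₁, h₂, rfl⟩, hnd.2.2,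
      fun x hx => hpos x (List.mem_cons_of_mem _ (List.mem_cons_of_mem _ hx)), rfl⟩,
      fun h => hnd.1 (List.mem_cons_of_mem _ h), hnd.2.1, ?_⟩
    ext x
    simp [or_assoc]
  · rintro ⟨h, hp, _, ⟨l, ⟨hq, l₁, l₂, h₁, h₂, rfl⟩, hnd, hpos, rfl⟩, hp₁, hp₂, rfl⟩
    refine ⟨_, ⟨h, hq, l₁, l₂, h₁, h₂, rfl⟩, ?_, ?_, ?_⟩
    · rw [List.nodup_cons, List.nodup_cons]
      refine ⟨fun h => ?_, hp₂, hnd⟩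
      rcases List.mem_cons.1 h with h | h
      · omega
      · exact hp₁ h
    · intro x hx
      rcases List.mem_cons.1 hx with rfl | hx
      · omega
      rcases List.mem_cons.1 hx with rfl | hx
      · omega
      · exact hpos x hx
    · ext x
      simp [or_assoc]

lemma StoredAt.congr {t : SynTree A} {p : ℕ} {l : List ℕ} (h : StoredAt m code t p l)
    (hm : ∀ x ∈ l, m' x = m x) : StoredAt m' code t p l := by
  induction t using inductionOn generalizing p l with
  | leaf a =>
    obtain ⟨h₁, h₂, rfl⟩ := h
    exact ⟨(hm p (by simp)).trans h₁, (hm (p + 1) (by simp)).trans h₂, rfl⟩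
  | node o c cs ih =>
    have forest : ∀ ts : List (SynTree A), (∀ t ∈ ts, t ∈ c :: cs) → ∀ q l,
        ListStoredAt m code ts q l → (∀ x ∈ l, m' x = m x) → ListStoredAt m' code ts q l := by
      intro ts
      induction ts with
      | nil => exact fun _ _ _ h _ => h
      | cons t ts ih' =>
        rintro hsub q l ⟨hq, l₁, l₂, h₁, h₂, rfl⟩ hm
        refine ⟨hq, l₁, l₂, ?_, ?_, rfl⟩
        · rw [hm q (by simp)]
          exact ih t (hsub t (by simp)) h₁ fun x hx => hm x (by simp [hx])
        · rw [hm (q + 1) (by simp)]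
          exact ih' (fun s hs => hsub s (List.mem_cons_of_mem _ hs)) _ _ h₂
            fun x hx => hm x (by simp [hx])
    obtain ⟨h, hq, l₁, l₂, h₁, h₂, rfl⟩ := h
    have := forest (c :: cs) (fun _ => id) (m (p + 1)) _ ⟨hq, l₁, l₂, h₁, h₂, rfl⟩
      fun x hx => hm x (List.mem_cons_of_mem _ (List.mem_cons_of_mem _ hx))
    obtain ⟨-, l₁', l₂', h₁', h₂', e⟩ := this
    rw [← hm (p + 1) (by simp)] at hq h₁' h₂' e ⊢
    exact ⟨(hm p (by simp)).trans h, hq, l₁', l₂', h₁', h₂', by rw [e]⟩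

lemma TreeAt.congr {t : SynTree A} {p : ℕ} {S : Set ℕ} (h : TreeAt m code t p S)
    (hm : ∀ x ∈ S, m' x = m x) : TreeAt m' code t p S := by
  obtain ⟨l, h, hnd, hpos, rfl⟩ := h
  exact ⟨l, h.congr hm, hnd, hpos, rfl⟩

lemma ForestAt.congr {ts : List (SynTree A)} {q : ℕ} {S : Set ℕ} (h : ForestAt m code ts q S)
    (hm : ∀ x ∈ S, m' x = m x) : ForestAt m' code ts q S := by
  induction ts generalizing q S with
  | nil => exact forestAt_nil.2 (forestAt_nil.1 h)
  | cons t ts ih =>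
    obtain ⟨hq, S₁, S₂, h₁, h₂, hd, hq₁, hq₂, rfl⟩ := forestAt_cons.1 h
    refine forestAt_cons.2 ⟨hq, S₁, S₂, ?_, ?_, hd, hq₁, hq₂, rfl⟩
    · rw [hm q (by simp)]
      exact h₁.congr fun x hx => hm x (by simp [hx])
    · rw [hm (q + 1) (by simp)]
      exact ih h₂ fun x hx => hm x (by simp [hx])

lemma TreeAt.ne_zero {t : SynTree A} {p : ℕ} {S : Set ℕ} (h : TreeAt m code t p S) : p ≠ 0 := by
  cases t with
  | leaf a => exact (treeAt_leaf.1 h).2.2.1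
  | node o c cs => exact (treeAt_node.1 h).2.1

lemma TreeAt.mem {t : SynTree A} {p : ℕ} {S : Set ℕ} (h : TreeAt m code t p S) : p ∈ S := by
  cases t with
  | leaf a => simp [(treeAt_leaf.1 h).2.2.2]
  | node o c cs =>
    obtain ⟨-, -, S', -, -, -, rfl⟩ := treeAt_node.1 h
    simp

/-- The root record of a tree can be copied to another place. -/
lemma TreeAt.copy {t : SynTree A} {p p' : ℕ} {S : Set ℕ} (h : TreeAt m code t p S)
    (hp' : p' ≠ 0) (h₁ : p' ∉ S) (h₂ : p' + 1 ∉ S) (hm : ∀ x ∈ S, m' x = m x)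
    (hm₁ : m' p' = m p) (hm₂ : m' (p' + 1) = m (p + 1)) :
    ∃ S', TreeAt m' code t p' S' ∧ S' ⊆ {p', p' + 1} ∪ S := by
  cases t with
  | leaf a =>
    obtain ⟨h0, ha, -, rfl⟩ := treeAt_leaf.1 h
    exact ⟨_, treeAt_leaf.2 ⟨hm₁.trans h0, hm₂.trans ha, hp', rfl⟩, Set.subset_union_left⟩
  | node o c cs =>
    obtain ⟨h0, -, S', hS', hp, hp1, rfl⟩ := treeAt_node.1 h
    refine ⟨_, treeAt_node.2 ⟨hm₁.trans h0, hp', S', ?_, fun hx => h₁ (.inr hx),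
      fun hx => h₂ (.inr hx), rfl⟩, Set.union_subset_union_right _ Set.subset_union_right⟩
    rw [hm₂]
    exact hS'.congr fun x hx => hm x (.inr hx)

/-- A tree in a stored forest may be replaced in place by another tree. -/
lemma ForestAt.replace {l₁ l₂ : List (SynTree A)} {t : SynTree A} {q : ℕ} {S : Set ℕ}
    (h : ForestAt m code (l₁ ++ t :: l₂) q S) :
    ∃ p T, TreeAt m code t p T ∧ T ⊆ S ∧ ∀ (m' : ℕ → ℕ) (t' : SynTree A) (T' : Set ℕ),
      (∀ x ∈ S \ T, m' x = m x) → TreeAt m' code t' p T' → Disjoint T' (S \ T) →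
      ∃ S', ForestAt m' code (l₁ ++ t' :: l₂) q S' ∧ S' ⊆ S \ T ∪ T' := by
  induction l₁ generalizing q S with
  | nil =>
    obtain ⟨hq, S₁, S₂, h₁, h₂, hd, hq₁, hq₂, rfl⟩ := forestAt_cons.1 h
    refine ⟨m q, S₁, h₁, fun x hx => .inr (.inl hx), fun m' t' T' hm ht' hdT => ?_⟩
    have hS₂ : ∀ x ∈ S₂, x ∈ ({q, q + 1} ∪ (S₁ ∪ S₂)) \ S₁ := fun x hx =>
      ⟨.inr (.inr hx), Set.disjoint_right.1 hd hx⟩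
    have hqm : q ∈ ({q, q + 1} ∪ (S₁ ∪ S₂)) \ S₁ := ⟨by simp, hq₁.1⟩
    have hqm' : q + 1 ∈ ({q, q + 1} ∪ (S₁ ∪ S₂)) \ S₁ := ⟨by simp, hq₁.2⟩
    rw [Set.disjoint_right] at hdT
    refine ⟨_, forestAt_cons.2 ⟨hq, T', S₂, (hm q hqm).symm ▸ ht', ?_,
      Set.disjoint_right.2 fun x hx => hdT (hS₂ x hx), ⟨hdT hqm, hdT hqm'⟩, hq₂, rfl⟩, ?_⟩
    · rw [hm _ hqm']
      exact h₂.congr fun x hx => hm x (hS₂ x hx)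
    · rintro x ((rfl | rfl) | hx | hx)
      exacts [.inl hqm, .inl hqm', .inr hx, .inl (hS₂ x hx)]
  | cons u l₁ ih =>
    obtain ⟨hq, S₁, S₂, h₁, h₂, hd, hq₁, hq₂, rfl⟩ := forestAt_cons.1 h
    obtain ⟨p, T, hT, hTS, hrep⟩ := ih h₂
    refine ⟨p, T, hT, fun x hx => .inr (.inr (hTS hx)), fun m' t' T' hm ht' hdT => ?_⟩
    have hS₁ : ∀ x ∈ S₁, x ∈ ({q, q + 1} ∪ (S₁ ∪ S₂)) \ T := fun x hx =>
      ⟨.inr (.inl hx), fun h => Set.disjoint_left.1 hd hx (hTS h)⟩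
    have hS₂ : ∀ x ∈ S₂ \ T, x ∈ ({q, q + 1} ∪ (S₁ ∪ S₂)) \ T := fun x hx =>
      ⟨.inr (.inr hx.1), hx.2⟩
    have hqm : q ∈ ({q, q + 1} ∪ (S₁ ∪ S₂)) \ T := ⟨by simp, fun h => hq₂.1 (hTS h)⟩
    have hqm' : q + 1 ∈ ({q, q + 1} ∪ (S₁ ∪ S₂)) \ T := ⟨by simp, fun h => hq₂.2 (hTS h)⟩
    rw [Set.disjoint_right] at hdT
    obtain ⟨S', hS', hsub⟩ := hrep m' t' T' (fun x hx => hm x (hS₂ x hx)) ht'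
      (Set.disjoint_right.2 fun x hx => hdT (hS₂ x hx))
    have hout : ∀ x, x ∈ ({q, q + 1} ∪ (S₁ ∪ S₂)) \ T → x ∉ S₂ → x ∉ S' := fun x hx hx2 h =>
      (hsub h).elim (fun h => hx2 h.1) (hdT hx)
    refine ⟨_, forestAt_cons.2 ⟨hq, S₁, S', ?_, ?_, ?_, hq₁, ⟨hout q hqm hq₂.1,
      hout _ hqm' hq₂.2⟩, rfl⟩, ?_⟩
    · rw [hm q hqm]
      exact h₁.congr fun x hx => hm x (hS₁ x hx)
    · rw [hm _ hqm']
      exact hS'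
    · exact Set.disjoint_left.2 fun x hx => hout x (hS₁ x hx) (Set.disjoint_left.1 hd hx)
    · rintro x ((rfl | rfl) | hx | hx)
      exacts [.inl hqm, .inl hqm', .inl (hS₁ x hx), (hsub hx).imp_left (hS₂ x)]

/-- A rewriting of a stored tree is carried out by changing the memory in the place of the node
where the merge happens. -/
lemma TreeAt.rewrite {t t' : SynTree A} (hr : Rewrite t t') {p : ℕ} {S : Set ℕ}
    (h : TreeAt m code t p S) :
    ∃ s s' r T, Merge s s' ∧ TreeAt m code s r T ∧ T ⊆ S ∧ ∀ (m' : ℕ → ℕ) (T' : Set ℕ),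
      (∀ x ∈ S \ T, m' x = m x) → TreeAt m' code s' r T' → Disjoint T' (S \ T) →
      ∃ S', TreeAt m' code t' p S' ∧ S' ⊆ S \ T ∪ T' := by
  induction hr generalizing p S with
  | @here t t' hm =>
    exact ⟨t, t', p, S, hm, h, subset_rfl, fun m' T' _ hT' _ => ⟨T', hT', Set.subset_union_right⟩⟩
  | @child o c c' cs cs' l₁ l₂ t t' h₁ h₂ _ ih =>
    obtain ⟨htag, hp, F, hF, hpF, hpF', rfl⟩ := treeAt_node.1 h
    rw [h₁] at hF
    obtain ⟨r, T, hT, hTF, hrep⟩ := hF.replace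
    obtain ⟨s, s', r', U, hss', hU, hUT, hrep'⟩ := ih hT
    refine ⟨s, s', r', U, hss', hU, fun x hx => .inr (hTF (hUT hx)), fun m' U' hm hU' hd => ?_⟩
    rw [Set.disjoint_right] at hd
    have hTU : ∀ x ∈ T \ U, x ∈ ({p, p + 1} ∪ F) \ U := fun x hx => ⟨.inr (hTF hx.1), hx.2⟩
    have hFT : ∀ x ∈ F \ T, x ∈ ({p, p + 1} ∪ F) \ U := fun x hx =>
      ⟨.inr hx.1, fun h => hx.2 (hUT h)⟩
    have hpm : p ∈ ({p, p + 1} ∪ F) \ U := ⟨by simp, fun h => hpF (hTF (hUT h))⟩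
    have hpm' : p + 1 ∈ ({p, p + 1} ∪ F) \ U := ⟨by simp, fun h => hpF' (hTF (hUT h))⟩
    obtain ⟨T', hT', hsub⟩ := hrep' m' U' (fun x hx => hm x (hTU x hx)) hU'
      (Set.disjoint_right.2 fun x hx => hd (hTU x hx))
    obtain ⟨F', hF', hsub'⟩ := hrep m' t' T' (fun x hx => hm x (hFT x hx)) hT'
      (Set.disjoint_right.2 fun x hx h => (hsub h).elim (fun h => hx.2 h.1) (hd (hFT x hx)))
    have hFF' : ∀ x ∈ F', x ∈ F ∧ x ∉ U ∨ x ∈ U' := by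
      intro x hx
      rcases hsub' hx with h | h
      · exact .inl ⟨h.1, (hFT x h).2⟩
      · exact (hsub h).imp_left fun h => ⟨hTF h.1, h.2⟩
    refine ⟨_, treeAt_node.2 ⟨(hm p hpm).trans htag, hp, F', ?_, fun h => ?_, fun h => ?_, rfl⟩, ?_⟩
    · rw [hm _ hpm', h₂]
      exact hF'
    · exact (hFF' p h).elim (fun h => hpF h.1) (hd hpm)
    · exact (hFF' _ h).elim (fun h => hpF' h.1) (hd hpm')
    · rintro x ((rfl | rfl) | hx)
      · exact .inl hpm
      · exact .inl hpm'
      · exact (hFF' x hx).imp_left fun h => ⟨.inr h.1, h.2⟩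

end SynTree

/-! ### Operations on stored trees and forests -/

namespace SynTree

open Function (update)

variable {A : Type*} {m m' : ℕ → ℕ} {code : A → ℕ}

/-- What a word can point to: at most one tree, where the address `0` stands for no tree, or a
linked list of trees. -/
inductive Obj (A : Type*) where
  | tree (x : Option (SynTree A))
  | forest (ts : List (SynTree A))

/-- The memory holds the object at the given address on the given set of addresses. -/
def ObjAt (m : ℕ → ℕ) (code : A → ℕ) : Obj A → ℕ → Set ℕ → Prop
  | .tree none, a, S => a = 0 ∧ S = ∅
  | .tree (some t), a, S => TreeAt m code t a S
  | .forest ts, a, S => ForestAt m code ts a S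

/-- The memory holds the listed objects at the given addresses on disjoint parts of `B`. -/
def Heap (m : ℕ → ℕ) (code : A → ℕ) : Set ℕ → List (Obj A × ℕ) → Prop
  | _, [] => True
  | B, (x, a) :: L => ∃ S ⊆ B, ObjAt m code x a S ∧ Heap m code (B \ S) L

lemma ObjAt.congr {x : Obj A} {a : ℕ} {S : Set ℕ} (h : ObjAt m code x a S)
    (hm : ∀ z ∈ S, m' z = m z) : ObjAt m' code x a S := by
  rcases x with (_ | t) | ts
  exacts [h, TreeAt.congr h hm, ForestAt.congr h hm]

lemma Heap.congr_mono {B B' : Set ℕ} {L : List (Obj A × ℕ)} (h : Heap m code B L)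
    (hm : ∀ z ∈ B, m' z = m z) (hB : B ⊆ B') : Heap m' code B' L := by
  induction L generalizing B B' with
  | nil => trivial
  | cons y L ih =>
    obtain ⟨S, hS, hy, hL⟩ := h
    exact ⟨S, hS.trans hB, hy.congr fun z hz => hm z (hS hz),
      ih hL (fun z hz => hm z hz.1) (Set.sdiff_subset_sdiff_left hB)⟩

lemma Heap.perm {B : Set ℕ} {L L' : List (Obj A × ℕ)} (h : Heap m code B L) (hp : L.Perm L') :
    Heap m code B L' := by
  induction hp generalizing B with
  | nil => trivial
  | cons y _ ih =>
    obtain ⟨S, hS, hy, hL⟩ := h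
    exact ⟨S, hS, hy, ih hL⟩
  | swap y z L =>
    obtain ⟨S, hS, hy, T, hT, hz, hL⟩ := h
    refine ⟨T, fun x hx => (hT hx).1, hz, S, fun x hx => ⟨hS hx, fun h => (hT h).2 hx⟩, hy, ?_⟩
    rwa [Set.sdiff_sdiff_comm]
  | trans _ _ ih₁ ih₂ => exact ih₂ (ih₁ h)

/-- Changing the first objects in their own place and in the new place `N` leaves the others
intact. -/
lemma Heap.step {B S T N : Set ℕ} {L : List (Obj A × ℕ)} {y : Obj A} {b : ℕ}
    (hL : Heap m code (B \ S) L) (hSB : S ⊆ B) (hm : ∀ z ∈ B \ S, m' z = m z)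
    (hN : Disjoint N B) (hT : T ⊆ S ∪ N) (hy : ObjAt m' code y b T) :
    Heap m' code (B ∪ N) ((y, b) :: L) := by
  refine ⟨T, fun x hx => (hT hx).imp_left (@hSB x), hy, hL.congr_mono hm fun x hx => ⟨.inl hx.1,
    fun h => (hT h).elim hx.2 fun h => Set.disjoint_left.1 hN h hx.1⟩⟩

/-- The memory after accumulating the forest at `q`, with free space at `f`. -/
def packMem (o : AccOp) (m : ℕ → ℕ) (f q : ℕ) : ℕ → ℕ :=
  if q = 0 ∨ m (q + 1) = 0 then m else update (update m f o.tag) (f + 1) q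

/-- The address of the accumulation of the forest at `q`. -/
def packAddr (m : ℕ → ℕ) (f q : ℕ) : ℕ :=
  if q = 0 then 0 else if m (q + 1) = 0 then m q else f

lemma packMem_of_lt (o : AccOp) (m : ℕ → ℕ) (f q : ℕ) {z : ℕ} (hz : z < f) :
    packMem o m f q z = m z := by
  unfold packMem
  split_ifs
  · rfl
  · rw [Function.update_of_ne (by omega), Function.update_of_ne (by omega)]

lemma Heap.pack {B : Set ℕ} {L : List (Obj A × ℕ)} {ts : List (SynTree A)} {q f : ℕ}
    (h : Heap m code B ((.forest ts, q) :: L)) (o : AccOp) (hf : 0 < f) (hB : ∀ z ∈ B, z < f) :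
    Heap (packMem o m f q) code (B ∪ Set.Ico f (f + 2))
      ((.tree (ofForest o ts), packAddr m f q) :: L) := by
  obtain ⟨S, hS, hq, hL⟩ := h
  have hdis : Disjoint (Set.Ico f (f + 2)) B :=
    Set.disjoint_left.2 fun x hx hx' => (hB x hx').not_ge hx.1
  have hagree : ∀ z ∈ B \ S, packMem o m f q z = m z := fun z hz =>
    packMem_of_lt _ _ _ _ (hB z hz.1)
  replace hq : ForestAt m code ts q S := hq
  rcases ts with _ | ⟨t, _ | ⟨s, ts⟩⟩
  · obtain ⟨rfl, rfl⟩ := forestAt_nil.1 hq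
    exact hL.step hS hagree hdis (Set.empty_subset _) ⟨by simp [packAddr], rfl⟩
  · obtain ⟨hq0, S₁, S₂, h₁, h₂, -, -, -, rfl⟩ := forestAt_cons.1 hq
    obtain ⟨hq1, rfl⟩ := forestAt_nil.1 h₂
    have haddr : packAddr m f q = m q := by simp [packAddr, hq0, hq1]
    have hmem : packMem o m f q = m := by simp [packMem, hq1]
    rw [hmem, haddr] at *
    exact hL.step hS (fun _ _ => rfl) hdis (T := S₁) (fun x hx => .inl (.inr (.inl hx))) h₁
  · obtain ⟨hq0, -, S₂, -, h₂, -⟩ := forestAt_cons.1 hq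
    have hq1 := (forestAt_cons.1 h₂).1
    refine hL.step hS hagree hdis (T := {f, f + 1} ∪ S) ?_ ?_
    · rintro x ((rfl | rfl) | hx)
      exacts [.inr ⟨le_rfl, by omega⟩, .inr ⟨by omega, by omega⟩, .inl hx]
    · have haddr : packAddr m f q = f := by simp [packAddr, hq0, hq1]
      have hmem : packMem o m f q = update (update m f o.tag) (f + 1) q := by
        simp [packMem, hq0, hq1]
      rw [haddr]
      refine treeAt_node.2 ⟨by simp [hmem], hf.ne', S, ?_, fun h => (hB _ (hS h)).false,
        fun h => absurd (hB _ (hS h)) (by omega), rfl⟩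
      rw [show packMem o m f q (f + 1) = q by simp [hmem]]
      exact hq.congr fun z hz => packMem_of_lt _ _ _ _ (hB z (hS hz))

/-- The memory after accumulating the trees at `x` and `y`, with free space at `f`. -/
def joinMem (o : AccOp) (m : ℕ → ℕ) (f x y : ℕ) : ℕ → ℕ :=
  if x = 0 ∨ y = 0 then m else
    update (update (update (update (update (update m f o.tag) (f + 1) (f + 2)) (f + 2) x)
      (f + 3) (f + 4)) (f + 4) y) (f + 5) 0

/-- The address of the accumulation of the trees at `x` and `y`. If one of them is missing, the sum
`x + y` is the address of the other. -/
def joinAddr (f x y : ℕ) : ℕ :=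
  if x = 0 ∨ y = 0 then x + y else f

lemma joinMem_of_lt (o : AccOp) (m : ℕ → ℕ) (f x y : ℕ) {z : ℕ} (hz : z < f) :
    joinMem o m f x y z = m z := by
  unfold joinMem
  split_ifs
  · rfl
  · iterate 6 rw [Function.update_of_ne (by omega)]

lemma Heap.join {B : Set ℕ} {L : List (Obj A × ℕ)} {x y : Option (SynTree A)} {a b f : ℕ}
    (h : Heap m code B ((.tree x, a) :: (.tree y, b) :: L)) (o : AccOp) (hf : 0 < f)
    (hB : ∀ z ∈ B, z < f) :
    Heap (joinMem o m f a b) code (B ∪ Set.Ico f (f + 6))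
      ((.tree (ofForest o (x.toList ++ y.toList)), joinAddr f a b) :: L) := by
  obtain ⟨S, hS, hx, T, hT, hy, hL⟩ := h
  rw [Set.sdiff_sdiff] at hL
  have hST : S ∪ T ⊆ B := Set.union_subset hS fun z hz => (hT hz).1
  have hdis : Disjoint (Set.Ico f (f + 6)) B :=
    Set.disjoint_left.2 fun x hx hx' => (hB x hx').not_ge hx.1
  have hagree : ∀ z ∈ B, joinMem o m f a b z = m z := fun z hz => joinMem_of_lt _ _ _ _ _ (hB z hz)
  have hagree' : ∀ z ∈ B \ (S ∪ T), joinMem o m f a b z = m z := fun z hz => hagree z hz.1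
  rcases x with _ | s
  · obtain ⟨rfl, rfl⟩ : a = 0 ∧ S = ∅ := hx
    have haddr : joinAddr f 0 b = b := by simp [joinAddr]
    rw [haddr]
    rcases y with _ | t <;>
      exact hL.step hST hagree' hdis (T := T) (fun z hz => .inl (.inr hz))
        (hy.congr fun z hz => hagree z (hT hz).1)
  rcases y with _ | t
  · obtain ⟨rfl, rfl⟩ : b = 0 ∧ T = ∅ := hy
    have haddr : joinAddr f a 0 = a := by simp [joinAddr]
    rw [haddr]
    exact hL.step hST hagree' hdis (T := S) (fun z hz => .inl (.inl hz))
      (hx.congr fun z hz => hagree z (hS hz))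
  replace hx : TreeAt m code s a S := hx
  replace hy : TreeAt m code t b T := hy
  have ha := hx.ne_zero
  have hb := hy.ne_zero
  have haddr : joinAddr f a b = f := by simp [joinAddr, ha, hb]
  have hout : ∀ i, f + i ∉ B := fun i h => absurd (hB _ h) (by omega)
  have hmem : ∀ z, joinMem o m f a b z = update (update (update (update (update (update m f o.tag)
      (f + 1) (f + 2)) (f + 2) a) (f + 3) (f + 4)) (f + 4) b) (f + 5) 0 z := by
    simp [joinMem, ha, hb]
  have m0 : joinMem o m f a b f = o.tag := by simp [hmem]
  have m1 : joinMem o m f a b (f + 1) = f + 2 := by simp [hmem]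
  have m2 : joinMem o m f a b (f + 2) = a := by simp [hmem]
  have m3 : joinMem o m f a b (f + 3) = f + 4 := by simp [hmem]
  have m4 : joinMem o m f a b (f + 4) = b := by simp [hmem]
  have m5 : joinMem o m f a b (f + 5) = 0 := by simp [hmem]
  rw [haddr]
  have hF₂ : ForestAt (joinMem o m f a b) code [t] (f + 4) ({f + 4, f + 5} ∪ (T ∪ ∅)) := by
    refine forestAt_cons.2 ⟨by omega, T, ∅, ?_, forestAt_nil.2 ⟨m5, rfl⟩, by simp,
      ⟨fun h => hout 4 (hT h).1, fun h => hout 5 (hT h).1⟩, by simp, rfl⟩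
    rw [m4]
    exact hy.congr fun z hz => hagree z (hT hz).1
  have hF₁ : ForestAt (joinMem o m f a b) code [s, t] (f + 2)
      ({f + 2, f + 3} ∪ (S ∪ ({f + 4, f + 5} ∪ (T ∪ ∅)))) := by
    refine forestAt_cons.2 ⟨by omega, S, _, ?_, m3 ▸ hF₂, ?_,
      ⟨fun h => hout 2 (hS h), fun h => hout 3 (hS h)⟩, ⟨?_, ?_⟩, rfl⟩
    · rw [m2]
      exact hx.congr fun z hz => hagree z (hS hz)
    · refine Set.disjoint_left.2 ?_
      rintro z hz ((rfl | rfl) | hz' | hz')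
      exacts [hout 4 (hS hz), hout 5 (hS hz), (hT hz').2 hz, hz']
    · rintro ((h | h) | h | h)
      exacts [by omega, by simp at h, hout 2 (hT h).1, h]
    · rintro ((h | h) | h | h)
      exacts [by omega, by simp at h, hout 3 (hT h).1, h]
  refine hL.step hST hagree' hdis
    (T := {f, f + 1} ∪ ({f + 2, f + 3} ∪ (S ∪ ({f + 4, f + 5} ∪ (T ∪ ∅))))) ?_ ?_
  · rintro z ((rfl | rfl) | (rfl | rfl) | hz | (rfl | rfl) | hz | hz)
    exacts [.inr ⟨by omega, by omega⟩, .inr ⟨by omega, by omega⟩, .inr ⟨by omega, by omega⟩,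
      .inr ⟨by omega, by omega⟩, .inl (.inl hz), .inr ⟨by omega, by omega⟩,
      .inr ⟨by omega, by omega⟩, .inl (.inr hz), hz.elim]
  · refine treeAt_node.2 ⟨m0, hf.ne', _, m1 ▸ hF₁, ?_, ?_, rfl⟩
    · rintro ((h | h) | h | (h | h) | h | h)
      exacts [by omega, by simp at h, hout 0 (hS h), by omega, by simp at h, hout 0 (hT h).1, h]
    · rintro ((h | h) | h | (h | h) | h | h)
      exacts [by omega, by simp at h, hout 1 (hS h), by omega, by simp at h, hout 1 (hT h).1, h]

/-- A tree is taken out of a stored forest by redirecting one word: the word `w`, which points to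
the forest, or the second word of the preceding cell. The removed cell stays available. -/
lemma ForestAt.extract {l₁ l₂ : List (SynTree A)} {t : SynTree A} {w : ℕ} {S : Set ℕ}
    (h : ForestAt m code (l₁ ++ t :: l₂) (m w) S) (hw : w ∉ S) :
    ∃ w' x T S', (w' = w ∨ w' ∈ S) ∧ m w' = x ∧ x ≠ 0 ∧
      ForestAt (update m w' (m (x + 1))) code (l₁ ++ l₂) (update m w' (m (x + 1)) w) S' ∧
      TreeAt (update m w' (m (x + 1))) code t (m x) T ∧
      w' ≠ x ∧ w' ≠ x + 1 ∧ w' ∉ T ∧ x ∉ T ∧ x + 1 ∉ T ∧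
      x ∈ S ∧ x + 1 ∈ S ∧ T ⊆ S ∧ S' ⊆ S \ ({x, x + 1} ∪ T) := by
  induction l₁ generalizing w S with
  | nil =>
    obtain ⟨hq, S₁, S₂, h₁, h₂, hd, hq₁, hq₂, rfl⟩ := forestAt_cons.1 h
    simp only [Set.mem_union, Set.mem_insert_iff, Set.mem_singleton_iff, not_or] at hw
    refine ⟨w, m w, S₁, S₂, .inl rfl, rfl, hq, ?_, ?_, hw.1.1, hw.1.2, hw.2.1, hq₁.1, hq₁.2,
      by simp, by simp, fun x hx => .inr (.inl hx), fun x hx => ⟨.inr (.inr hx), ?_⟩⟩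
    · rw [Function.update_self]
      exact h₂.congr fun z hz => Function.update_of_ne (by rintro rfl; exact hw.2.2 hz) _ _
    · exact h₁.congr fun z hz => Function.update_of_ne (by rintro rfl; exact hw.2.1 hz) _ _
    · rintro ((rfl | rfl) | hx')
      exacts [hq₂.1 hx, hq₂.2 hx, Set.disjoint_left.1 hd hx' hx]
  | cons u l₁ ih =>
    obtain ⟨hq, S₁, S₂, h₁, h₂, hd, hq₁, hq₂, rfl⟩ := forestAt_cons.1 h
    simp only [Set.mem_union, Set.mem_insert_iff, Set.mem_singleton_iff, not_or] at hw
    obtain ⟨w', x, T, S', hw', rfl, hx, hF, hT, n₁, n₂, n₃, n₄, n₅, x₁, x₂, hTS, hS'⟩ :=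
      ih h₂ hq₂.2
    have hne : w' ≠ w := by
      rintro rfl
      exact hw'.elim hw.1.2 hw.2.2
    have hne' : w' ≠ m w := by
      rintro e
      exact hw'.elim (by omega) fun h => hq₂.1 (e ▸ h)
    have hw'S₁ : w' ∉ S₁ := fun h =>
      hw'.elim (fun e => hq₁.2 (e ▸ h)) (Set.disjoint_left.1 hd h)
    refine ⟨w', m w', T, {m w, m w + 1} ∪ (S₁ ∪ S'), .inr ?_, rfl, hx, ?_, hT, n₁, n₂, n₃, n₄, n₅,
      .inr (.inr x₁), .inr (.inr x₂), fun z hz => .inr (.inr (hTS hz)), ?_⟩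
    · exact hw'.elim (fun e => by simp [e]) fun h => .inr (.inr h)
    · rw [Function.update_of_ne hne.symm]
      refine forestAt_cons.2 ⟨hq, S₁, S', ?_, hF, ?_, hq₁,
        ⟨fun h => hq₂.1 (hS' h).1, fun h => hq₂.2 (hS' h).1⟩, rfl⟩
      · rw [Function.update_of_ne hne'.symm]
        exact h₁.congr fun z hz => Function.update_of_ne (by rintro rfl; exact hw'S₁ hz) _ _
      · exact Set.disjoint_left.2 fun z hz hz' => Set.disjoint_left.1 hd hz (hS' hz').1
    · have hsub : {m w', m w' + 1} ∪ T ⊆ S₂ := by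
        rintro z ((rfl | rfl) | hz)
        exacts [x₁, x₂, hTS hz]
      rintro z ((rfl | rfl) | hz | hz)
      · exact ⟨by simp, fun h => hq₂.1 (hsub h)⟩
      · exact ⟨by simp, fun h => hq₂.2 (hsub h)⟩
      · exact ⟨.inr (.inl hz), fun h => Set.disjoint_left.1 hd hz (hsub h)⟩
      · exact ⟨.inr (.inr (hS' hz).1), (hS' hz).2⟩

/-- The memory after turning the tree in the cell `x` into the list of its factors. -/
def factorsMem (m : ℕ → ℕ) (x : ℕ) : ℕ → ℕ :=
  if m (m x) = 1 then m else update m (x + 1) 0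

/-- The address of the list of factors of the tree in the cell `x`: the list of children of a node
labelled `&`; for other trees, the cell itself becomes the list. -/
def factorsAddr (m : ℕ → ℕ) (x : ℕ) : ℕ :=
  if m (m x) = 1 then m (m x + 1) else x

lemma TreeAt.factorsAt {t : SynTree A} {x : ℕ} {T : Set ℕ} (h : TreeAt m code t (m x) T)
    (hx : x ≠ 0) (h₁ : x ∉ T) (h₂ : x + 1 ∉ T) :
    ∃ S, ForestAt (factorsMem m x) code (factors .prior t) (factorsAddr m x) S ∧
      S ⊆ {x, x + 1} ∪ T := by
  by_cases ht : m (m x) = 1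
  · simp only [factorsMem, factorsAddr, if_pos ht]
    rcases t with a | ⟨_ | _, c, cs⟩
    · have := (treeAt_leaf.1 h).1
      omega
    · obtain ⟨-, -, S, hS, -, -, rfl⟩ := treeAt_node.1 h
      exact ⟨S, hS, fun z hz => .inr (.inr hz)⟩
    · have := (treeAt_node.1 h).1
      rw [ht] at this
      cases this
  · have hf : factors .prior t = [t] := by
      rcases t with a | ⟨_ | _, c, cs⟩
      · rfl
      · exact (ht (treeAt_node.1 h).1).elim
      · rfl
    simp only [factorsMem, factorsAddr, if_neg ht, hf]
    refine ⟨_, forestAt_cons.2 ⟨hx, T, ∅, ?_, forestAt_nil.2 ⟨Function.update_self _ _ _, rfl⟩,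
      by simp, ⟨h₁, h₂⟩, by simp, rfl⟩, by simp⟩
    rw [Function.update_of_ne (by omega)]
    exact h.congr fun z hz => Function.update_of_ne (by rintro rfl; exact h₂ hz) _ _

/-- The memory after cutting a list behind the cell `a`; `a = 0` means a cut at the start. -/
def splitMem (m : ℕ → ℕ) (a : ℕ) : ℕ → ℕ :=
  if a = 0 then m else update m (a + 1) 0

lemma ForestAt.split {P R : List (SynTree A)} {q : ℕ} {S : Set ℕ}
    (h : ForestAt m code (P ++ R) q S) :
    ∃ a S₁ S₂, (a = 0 ∨ a ∈ S ∧ a + 1 ∈ S) ∧ Disjoint S₁ S₂ ∧ S₁ ∪ S₂ ⊆ S ∧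
      ForestAt (splitMem m a) code P (if a = 0 then 0 else q) S₁ ∧
      ForestAt (splitMem m a) code R (if a = 0 then q else m (a + 1)) S₂ := by
  -- A nonempty first part is cut off behind its last cell.
  have key : ∀ (P : List (SynTree A)) (t : SynTree A) (q : ℕ) (S : Set ℕ),
      ForestAt m code (t :: P ++ R) q S → ∃ a S₁ S₂, a ≠ 0 ∧ (a ∈ S ∧ a + 1 ∈ S) ∧
      Disjoint S₁ S₂ ∧ S₁ ∪ S₂ ⊆ S ∧ ForestAt (update m (a + 1) 0) code (t :: P) q S₁ ∧
      ForestAt (update m (a + 1) 0) code R (m (a + 1)) S₂ := by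
    intro P
    induction P with
    | nil =>
      intro t q S h
      obtain ⟨hq, S₁, S₂, h₁, h₂, hd, hq₁, hq₂, rfl⟩ := forestAt_cons.1 h
      refine ⟨q, {q, q + 1} ∪ (S₁ ∪ ∅), S₂, hq, by simp, ?_, ?_, ?_, ?_⟩
      · refine Set.disjoint_left.2 ?_
        rintro z ((rfl | rfl) | hz | hz) hz'
        exacts [hq₂.1 hz', hq₂.2 hz', Set.disjoint_left.1 hd hz hz', hz]
      · rintro z (((rfl | rfl) | hz | hz) | hz)
        exacts [by simp, by simp, .inr (.inl hz), hz.elim, .inr (.inr hz)]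
      · refine forestAt_cons.2 ⟨hq, S₁, ∅, ?_, forestAt_nil.2 ⟨Function.update_self _ _ _, rfl⟩,
          by simp, hq₁, by simp, rfl⟩
        rw [Function.update_of_ne (by omega)]
        exact h₁.congr fun z hz => Function.update_of_ne (by rintro rfl; exact hq₁.2 hz) _ _
      · exact h₂.congr fun z hz => Function.update_of_ne (by rintro rfl; exact hq₂.2 hz) _ _
    | cons s P ih =>
      intro t q S h
      obtain ⟨hq, S₁, S₂, h₁, h₂, hd, hq₁, hq₂, rfl⟩ := forestAt_cons.1 h
      obtain ⟨a, T₁, T₂, ha, haS, hdT, hT, hP, hR⟩ := ih s _ _ h₂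
      have hT₁ : T₁ ⊆ S₂ := Set.subset_union_left.trans hT
      have hT₂ : T₂ ⊆ S₂ := Set.subset_union_right.trans hT
      refine ⟨a, {q, q + 1} ∪ (S₁ ∪ T₁), T₂, ha, ⟨.inr (.inr haS.1), .inr (.inr haS.2)⟩, ?_, ?_,
        ?_, hR⟩
      · refine Set.disjoint_left.2 ?_
        rintro z ((rfl | rfl) | hz | hz) hz'
        exacts [hq₂.1 (hT₂ hz'), hq₂.2 (hT₂ hz'), Set.disjoint_left.1 hd hz (hT₂ hz'),
          Set.disjoint_left.1 hdT hz hz']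
      · rintro z (((rfl | rfl) | hz | hz) | hz)
        exacts [by simp, by simp, .inr (.inl hz), .inr (.inr (hT₁ hz)), .inr (.inr (hT₂ hz))]
      · refine forestAt_cons.2 ⟨hq, S₁, T₁, ?_, ?_, hd.mono_right hT₁, hq₁,
          ⟨fun h => hq₂.1 (hT₁ h), fun h => hq₂.2 (hT₁ h)⟩, rfl⟩
        · rw [Function.update_of_ne (by rintro rfl; exact hq₂.1 haS.2)]
          exact h₁.congr fun z hz => Function.update_of_ne
            (by rintro rfl; exact Set.disjoint_left.1 hd hz haS.2) _ _
        · rw [Function.update_of_ne (fun e : q + 1 = a + 1 => hq₂.2 (e ▸ haS.2))]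
          exact hP
  cases P with
  | nil =>
    exact ⟨0, ∅, S, .inl rfl, by simp, by simp, forestAt_nil.2 ⟨by simp, rfl⟩, by
      simpa [splitMem] using h⟩
  | cons t P =>
    obtain ⟨a, S₁, S₂, ha, haS, hd, hsub, h₁, h₂⟩ := key P t q S h
    refine ⟨a, S₁, S₂, .inr haS, hd, hsub, ?_⟩
    simp only [splitMem, if_neg ha]
    exact ⟨h₁, h₂⟩

/-- The memory after taking a tree out of a list, the word `w` pointing to its cell. -/
def unlinkMem (m : ℕ → ℕ) (w : ℕ) : ℕ → ℕ := update m w (m (m w + 1))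

/-- The memory after taking out a tree and cutting its list of factors behind the cell `a`. -/
def takeMem (m : ℕ → ℕ) (w a : ℕ) : ℕ → ℕ :=
  splitMem (factorsMem (unlinkMem m w) (m w)) a

/-- The address of the first part of the cut list of factors. -/
def takeFst (m : ℕ → ℕ) (w a : ℕ) : ℕ :=
  if a = 0 then 0 else factorsAddr (unlinkMem m w) (m w)

/-- The address of the second part of the cut list of factors. -/
def takeSnd (m : ℕ → ℕ) (w a : ℕ) : ℕ :=
  if a = 0 then factorsAddr (unlinkMem m w) (m w) else
    factorsMem (unlinkMem m w) (m w) (a + 1)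

/-- For a suitable choice of the words `w'` and `a`, a given tree is taken out of a stored forest
and its list of factors is cut at a given place. -/
lemma Heap.take {B : Set ℕ} {L : List (Obj A × ℕ)} {l₁ l₂ : List (SynTree A)} {t : SynTree A}
    {P R : List (SynTree A)} {w : ℕ} (h : Heap m code B ((.forest (l₁ ++ t :: l₂), m w) :: L))
    (hw : w ∉ B) (ht : factors .prior t = P ++ R) :
    ∃ w' a, (w' = w ∨ w' ∈ B) ∧ (a = 0 ∨ a ∈ B) ∧
      (∀ z, z ≠ w → z ∉ B → takeMem m w' a z = m z) ∧
      Heap (takeMem m w' a) code B ((.forest (l₁ ++ l₂), takeMem m w' a w) ::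
        (.forest P, takeFst m w' a) :: (.forest R, takeSnd m w' a) :: L) := by
  obtain ⟨S, hSB, hF, hL⟩ := h
  obtain ⟨w', x, T, S', hw', rfl, hx0, hF', hT, n₁, n₂, n₃, n₄, n₅, x₁, x₂, hTS, hS'⟩ :=
    ForestAt.extract hF (fun h => hw (hSB h))
  change ForestAt (unlinkMem m w') code _ (unlinkMem m w' w) S' at hF'
  change TreeAt (unlinkMem m w') code t _ T at hT
  have hux : unlinkMem m w' (m w') = m (m w') := Function.update_of_ne n₁.symm _ _
  rw [← hux] at hT
  obtain ⟨U, hU, hUsub⟩ := hT.factorsAt hx0 n₄ n₅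
  rw [ht] at hU
  obtain ⟨a, U₁, U₂, ha, hd, hUU, hP, hR⟩ := hU.split
  have hXS : {m w', m w' + 1} ∪ T ⊆ S := by
    rintro z ((rfl | rfl) | hz)
    exacts [x₁, x₂, hTS hz]
  have hagree : ∀ z, z ∉ {m w', m w' + 1} ∪ T → takeMem m w' a z = unlinkMem m w' z := by
    intro z hz
    have h1 : splitMem (factorsMem (unlinkMem m w') (m w')) a z =
        factorsMem (unlinkMem m w') (m w') z := by
      unfold splitMem
      split_ifs with h
      · rfl
      · refine Function.update_of_ne ?_ _ _
        rintro rfl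
        exact hz (hUsub (ha.resolve_left h).2)
    refine h1.trans ?_
    unfold factorsMem
    split_ifs with h
    · rfl
    · refine Function.update_of_ne ?_ _ _
      rintro rfl
      exact hz (by simp)
  have hagree' : ∀ z, z ≠ w → z ∉ S → takeMem m w' a z = m z := by
    intro z hzw hz
    refine (hagree z fun h => hz (hXS h)).trans (Function.update_of_ne ?_ _ _)
    rintro rfl
    exact hw'.elim hzw hz
  have hU₁ : U₁ ⊆ {m w', m w' + 1} ∪ T := (Set.subset_union_left.trans hUU).trans hUsub
  have hU₂ : U₂ ⊆ {m w', m w' + 1} ∪ T := (Set.subset_union_right.trans hUU).trans hUsub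
  refine ⟨w', a, hw'.imp_right (@hSB w'), ha.imp_right fun h => hSB (hXS (hUsub h.1)),
    fun z hzw hz => hagree' z hzw fun h => hz (hSB h), S', fun z hz => hSB (hS' hz).1, ?_,
    U₁, fun z hz => ⟨hSB (hXS (hU₁ hz)), fun h => (hS' h).2 (hU₁ hz)⟩, hP,
    U₂, fun z hz => ⟨⟨hSB (hXS (hU₂ hz)), fun h => (hS' h).2 (hU₂ hz)⟩,
      Set.disjoint_right.1 hd hz⟩, hR, ?_⟩
  · rw [hagree w fun h => hw (hSB (hXS h))]
    exact hF'.congr fun z hz => hagree z (hS' hz).2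
  · refine hL.congr_mono (fun z hz => hagree' z (fun e => hw (e ▸ hz.1)) hz.2) ?_
    exact fun z hz => ⟨⟨⟨hz.1, fun h => hz.2 (hS' h).1⟩, fun h => hz.2 (hXS (hU₁ h))⟩,
      fun h => hz.2 (hXS (hU₂ h))⟩

end SynTree

/-! ### Structured programs for the random access machine -/

/-- Programs without loops: basic instructions, composition, and conditional execution. -/
inductive RamCmd where
  | const (i c : ℕ)
  | add (i j k : ℕ)
  | sub (i j k : ℕ)
  | load (i j : ℕ)
  | store (i j : ℕ)
  | seq (c d : RamCmd)
  /-- executes `c` if `r_j` is zero -/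
  | ifZero (j : ℕ) (c : RamCmd)

namespace RamCmd

local infixr:60 " ;; " => RamCmd.seq

open Function (update)

/-- The number of instructions of the compiled program. -/
def size : RamCmd → ℕ
  | seq c d => c.size + d.size
  | ifZero _ c => c.size + 1
  | _ => 1

/-- The machine program for a structured program that is placed at instruction number `b`. -/
def compile : RamCmd → ℕ → List RamInstr
  | const i c, _ => [.const i c]
  | add i j k, _ => [.add i j k]
  | sub i j k, _ => [.sub i j k]
  | load i j, _ => [.load i j]
  | store i j, _ => [.store i j]
  | seq c d, b => c.compile b ++ d.compile (b + c.size)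
  | ifZero j c, b => .jpos j (b + 1 + c.size) :: c.compile (b + 1)

/-- The effect of a structured program on the registers and the memory. -/
def eval : RamCmd → (ℕ → ℕ) × (ℕ → ℕ) → (ℕ → ℕ) × (ℕ → ℕ)
  | const i c, s => (update s.1 i c, s.2)
  | add i j k, s => (update s.1 i (s.1 j + s.1 k), s.2)
  | sub i j k, s => (update s.1 i (s.1 j - s.1 k), s.2)
  | load i j, s => (update s.1 i (s.2 (s.1 j)), s.2)
  | store i j, s => (s.1, update s.2 (s.1 i) (s.1 j))
  | seq c d, s => d.eval (c.eval s)
  | ifZero j c, s => if 0 < s.1 j then s else c.eval s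

lemma length_compile (c : RamCmd) (b : ℕ) : (c.compile b).length = c.size := by
  induction c generalizing b with
  | seq c d ihc ihd => simp [compile, size, ihc, ihd]
  | ifZero j c ih => simp [compile, size, ih]
  | _ => rfl

/-- A compiled program runs from its first instruction to the one behind its last in at most as many
steps as it has instructions. -/
lemma iterate_step_compile (c : RamCmd) (pre post : List RamInstr) (s : (ℕ → ℕ) × (ℕ → ℕ)) :
    ∃ u ≤ c.size, (RamState.step (pre ++ c.compile pre.length ++ post))^[u]
      ⟨pre.length, s.1, s.2⟩ = ⟨pre.length + c.size, (c.eval s).1, (c.eval s).2⟩ := by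
  induction c generalizing pre post s with
  | seq c d ihc ihd =>
    obtain ⟨u₁, hu₁, h₁⟩ := ihc pre (d.compile (pre.length + c.size) ++ post) s
    obtain ⟨u₂, hu₂, h₂⟩ := ihd (pre ++ c.compile pre.length) post (c.eval s)
    simp only [List.length_append, length_compile] at h₂
    refine ⟨u₂ + u₁, by simp only [size]; omega, ?_⟩
    simp only [compile, eval, size, List.append_assoc, Function.iterate_add_apply] at h₁ h₂ ⊢
    rw [h₁, h₂, Nat.add_assoc]
  | ifZero j c ih =>
    have hget : (pre ++ (ifZero j c).compile pre.length ++ post)[pre.length]? =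
        some (.jpos j (pre.length + 1 + c.size)) := by simp [compile]
    by_cases hj : 0 < s.1 j
    · refine ⟨1, by simp [size], ?_⟩
      simp only [Function.iterate_one, RamState.step, hget, RamState.exec, hj, if_true, eval, size]
      rw [Nat.add_assoc, Nat.add_comm 1]
    · obtain ⟨u, hu, h⟩ := ih (pre ++ [.jpos j (pre.length + 1 + c.size)]) post s
      refine ⟨u + 1, by simp only [size]; omega, ?_⟩
      rw [Function.iterate_succ_apply]
      simp only [RamState.step, hget, RamState.exec, hj, if_false, eval, size]
      simp only [List.length_append, List.length_singleton, List.append_assoc,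
        List.singleton_append] at h
      simp only [compile, List.append_assoc, List.cons_append] at h ⊢
      rw [h, Nat.add_assoc, Nat.add_comm 1]
  | _ =>
    refine ⟨1, le_rfl, ?_⟩
    simp [RamState.step, compile, RamState.exec, eval, size]

lemma haltsWithin_compile (c : RamCmd) (s : (ℕ → ℕ) × (ℕ → ℕ)) {t : ℕ} (ht : c.size ≤ t) :
    RamState.HaltsWithin (c.compile 0) t ⟨0, s.1, s.2⟩ ⟨c.size, (c.eval s).1, (c.eval s).2⟩ := by
  obtain ⟨u, hu, h⟩ := iterate_step_compile c [] [] s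
  simp only [List.length_nil, List.nil_append, List.append_nil, Nat.zero_add] at h
  exact ⟨u, hu.trans ht, h, (length_compile c 0).le⟩

/-! ### The program that merges two children of a Pareto node -/

open SynTree

/-- Takes the cell that the word `r_w` points to out of its list. -/
def unlink (w : ℕ) : RamCmd :=
  load 20 w ;; add 21 20 7 ;; load 22 21 ;; store w 22

/-- Puts the list of factors of the tree in the cell `r₂₀` into `r_e`. -/
def factorList (e : ℕ) : RamCmd :=
  load 23 20 ;; load 24 23 ;;
  -- With the tag `t`, the number `t - (t - 1) - (t - 1)` is positive only for `t = 1`.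
  sub 25 24 7 ;; sub 24 24 25 ;; sub 24 24 25 ;;
  add 26 23 7 ;; load e 26 ;; ifZero 24 (store 21 8 ;; add e 20 8)

/-- Cuts the list `r_e` behind the cell `r_a`, into `r_d` and `r_e`. -/
def split (a d e : ℕ) : RamCmd :=
  const d 0 ;; sub 28 7 a ;;
  ifZero 28 (add d e 8 ;; add 29 a 7 ;; load e 29 ;; store 29 8)

/-- Accumulates the list `r_r` by `o`; the result replaces it. -/
def pack (o : AccOp) (r : ℕ) : RamCmd :=
  const 20 0 ;; sub 21 7 r ;;
  ifZero 21 (add 22 r 7 ;; load 23 22 ;; load 20 r ;; sub 24 7 23 ;;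
    ifZero 24 (const 25 o.tag ;; store 1 25 ;; add 26 1 7 ;; store 26 r ;; add 20 1 8)) ;;
  add 1 1 7 ;; add 1 1 7 ;; add r 20 8

/-- Accumulates the trees `r_x` and `r_y` by `o`; the result replaces the first. -/
def join (o : AccOp) (x y : ℕ) : RamCmd :=
  add 20 x y ;; sub 21 7 x ;; sub 22 7 y ;; const 30 2 ;; add 31 1 30 ;; add 32 31 30 ;;
  ifZero 21 (ifZero 22 (const 23 o.tag ;; store 1 23 ;; add 24 1 7 ;; store 24 31 ;;
    store 31 x ;; add 24 31 7 ;; store 24 32 ;; store 32 y ;; add 24 32 7 ;; store 24 8 ;;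
    add 20 1 8)) ;;
  add 1 32 30 ;; add x 20 8

/-- Copies the record at `r₁₀` to the address `r₂`, with second word at `r₉`. -/
def copyRecord : RamCmd :=
  load 20 10 ;; add 21 10 7 ;; load 22 21 ;; store 2 20 ;; store 9 22

/-- The program that carries out one merge. Register `0` holds the root, `1` the start of the free
memory, `2` the address of the node, `3` and `4` the addresses of the words that point to the cells
of the two children, `5` and `6` the cells behind which the lists of factors are cut, `7` the
constant one, `8` the constant zero, and `9` the address of the second word of the node. The parts
of the first list of factors are kept in `10` and `11`, those of the second in `12` and `13`, the
remaining children in `14`. Registers from `20` on are used for intermediate results. -/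
def merge : RamCmd :=
  const 7 1 ;; const 8 0 ;; add 9 2 7 ;;
  unlink 3 ;; factorList 11 ;; split 5 10 11 ;;
  unlink 4 ;; factorList 13 ;; split 6 12 13 ;;
  load 14 9 ;;
  pack .prior 10 ;; pack .prior 12 ;; join .pareto 10 12 ;;
  pack .prior 11 ;; pack .prior 13 ;; join .pareto 11 13 ;;
  join .prior 10 11 ;; pack .pareto 14 ;; join .pareto 10 14 ;;
  copyRecord

variable {s : (ℕ → ℕ) × (ℕ → ℕ)}

lemma eval_unlink {w : ℕ} (hw : w < 20) (h7 : s.1 7 = 1) :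
    ((unlink w).eval s).2 = unlinkMem s.2 (s.1 w) ∧
    ((unlink w).eval s).1 20 = s.2 (s.1 w) ∧ ((unlink w).eval s).1 21 = s.2 (s.1 w) + 1 ∧
    ∀ i < 20, ((unlink w).eval s).1 i = s.1 i := by
  refine ⟨?_, ?_, ?_, fun i hi => ?_⟩ <;>
  simp (disch := omega) only [unlink, eval, Function.update_self, Function.update_of_ne, h7,
    unlinkMem]

lemma eval_factorList {e : ℕ} (he : 9 < e ∧ e < 20) (h7 : s.1 7 = 1) (h8 : s.1 8 = 0)
    (h21 : s.1 21 = s.1 20 + 1) :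
    ((factorList e).eval s).2 = factorsMem s.2 (s.1 20) ∧
    ((factorList e).eval s).1 e = factorsAddr s.2 (s.1 20) ∧
    ∀ i < 20, i ≠ e → ((factorList e).eval s).1 i = s.1 i := by
  by_cases ht : s.2 (s.2 (s.1 20)) = 1
  · refine ⟨?_, ?_, fun i hi hie => ?_⟩ <;>
    simp (disch := omega) [factorList, eval, h7, ht, factorsMem, factorsAddr,
      Function.update_of_ne]
  · have hz : ¬ 0 < s.2 (s.2 (s.1 20)) - (s.2 (s.2 (s.1 20)) - 1) - (s.2 (s.2 (s.1 20)) - 1) := by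
      omega
    refine ⟨?_, ?_, fun i hi hie => ?_⟩ <;>
    simp (disch := omega) only [factorList, eval, h7, h8, h21, ht, factorsMem, factorsAddr,
      Function.update_self, Function.update_of_ne, if_neg hz, if_false, Nat.add_zero]

lemma eval_split {a d e : ℕ} (ha : a < 9) (hd : 9 < d ∧ d < 20) (he : 9 < e ∧ e < 20)
    (hde : d ≠ e) (h7 : s.1 7 = 1) (h8 : s.1 8 = 0) :
    ((split a d e).eval s).2 = splitMem s.2 (s.1 a) ∧
    ((split a d e).eval s).1 d = (if s.1 a = 0 then 0 else s.1 e) ∧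
    ((split a d e).eval s).1 e = (if s.1 a = 0 then s.1 e else s.2 (s.1 a + 1)) ∧
    ∀ i < 20, i ≠ d → i ≠ e → ((split a d e).eval s).1 i = s.1 i := by
  by_cases hz : s.1 a = 0
  · refine ⟨?_, ?_, ?_, fun i hi hid hie => ?_⟩ <;>
    simp (disch := omega) [split, eval, h7, hz, splitMem, Function.update_of_ne]
  · have hz' : ¬ 0 < 1 - s.1 a := by omega
    refine ⟨?_, ?_, ?_, fun i hi hid hie => ?_⟩ <;>
    simp (disch := omega) only [split, eval, h7, h8, splitMem, hz,
      Function.update_self, Function.update_of_ne, if_neg hz', if_false, Nat.add_zero]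

/-- Unlinking, listing the factors and cutting the list. -/
lemma eval_take {w a d e : ℕ} (hw : w < 9) (ha : a < 9) (hd : 9 < d ∧ d < 20)
    (he : 9 < e ∧ e < 20) (hde : d ≠ e) (h7 : s.1 7 = 1) (h8 : s.1 8 = 0)
    {s' : (ℕ → ℕ) × (ℕ → ℕ)}
    (hs' : s' = (split a d e).eval ((factorList e).eval ((unlink w).eval s))) :
    s'.2 = takeMem s.2 (s.1 w) (s.1 a) ∧ s'.1 d = takeFst s.2 (s.1 w) (s.1 a) ∧
    s'.1 e = takeSnd s.2 (s.1 w) (s.1 a) ∧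
    ∀ i < 20, i ≠ d → i ≠ e → s'.1 i = s.1 i := by
  obtain ⟨m₁, r20, r21, k₁⟩ := eval_unlink (w := w) (s := s) (by omega) h7
  set s₁ := (unlink w).eval s
  obtain ⟨m₂, re, k₂⟩ := eval_factorList (s := s₁) he (by rw [k₁ 7 (by omega), h7])
    (by rw [k₁ 8 (by omega), h8]) (by rw [r21, r20])
  set s₂ := (factorList e).eval s₁
  obtain ⟨m₃, rd, re', k₃⟩ := eval_split (s := s₂) ha hd he hde
    (by rw [k₂ 7 (by omega) (by omega), k₁ 7 (by omega), h7])
    (by rw [k₂ 8 (by omega) (by omega), k₁ 8 (by omega), h8])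
  have hsa : s₂.1 a = s.1 a := by rw [k₂ a (by omega) (by omega), k₁ a (by omega)]
  rw [← hs'] at m₃ rd re' k₃
  rw [hsa] at m₃ rd re'
  rw [r20, m₁] at m₂ re
  rw [m₂] at m₃ re'
  rw [re] at rd re'
  refine ⟨m₃, rd, re', fun i hi hid hie => ?_⟩
  rw [k₃ i hi hid hie, k₂ i hi hie, k₁ i hi]

lemma eval_pack {o : AccOp} {r : ℕ} (hr : 9 < r ∧ r < 20) (h7 : s.1 7 = 1) (h8 : s.1 8 = 0) :
    ((pack o r).eval s).2 = packMem o s.2 (s.1 1) (s.1 r) ∧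
    ((pack o r).eval s).1 r = packAddr s.2 (s.1 1) (s.1 r) ∧
    ((pack o r).eval s).1 1 = s.1 1 + 2 ∧
    ∀ i < 20, i ≠ 1 → i ≠ r → ((pack o r).eval s).1 i = s.1 i := by
  by_cases hz : s.1 r = 0
  · refine ⟨?_, ?_, ?_, fun i hi hid hie => ?_⟩ <;>
    simp (disch := omega) [pack, eval, h7, h8, packMem, packAddr, hz, Function.update_of_ne]
  by_cases hn : s.2 (s.1 r + 1) = 0
  · refine ⟨?_, ?_, ?_, fun i hi hid hie => ?_⟩ <;>
    simp (disch := omega) [pack, eval, h7, h8, packMem, packAddr, hn, hz,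
      Function.update_of_ne]
  · refine ⟨?_, ?_, ?_, fun i hi hid hie => ?_⟩ <;>
    simp (disch := omega) [pack, eval, h7, h8, packMem, packAddr, hz, hn,
      Function.update_of_ne]

lemma eval_join {o : AccOp} {x y : ℕ} (hx : 9 < x ∧ x < 20) (hy : 9 < y ∧ y < 20)
    (h7 : s.1 7 = 1) (h8 : s.1 8 = 0) :
    ((join o x y).eval s).2 = joinMem o s.2 (s.1 1) (s.1 x) (s.1 y) ∧
    ((join o x y).eval s).1 x = joinAddr (s.1 1) (s.1 x) (s.1 y) ∧
    ((join o x y).eval s).1 1 = s.1 1 + 6 ∧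
    ∀ i < 20, i ≠ 1 → i ≠ x → ((join o x y).eval s).1 i = s.1 i := by
  by_cases hz : s.1 x = 0
  · refine ⟨?_, ?_, ?_, fun i hi hid hie => ?_⟩ <;>
    simp (disch := omega) [join, eval, h7, h8, joinMem, joinAddr, hz, Function.update_of_ne]
  by_cases hn : s.1 y = 0
  · refine ⟨?_, ?_, ?_, fun i hi hid hie => ?_⟩ <;>
    simp (disch := omega) [join, eval, h7, h8, joinMem, joinAddr, hn, hz,
      Function.update_of_ne]
  · refine ⟨?_, ?_, ?_, fun i hi hid hie => ?_⟩ <;>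
    simp (disch := omega) [join, eval, h7, h8, joinMem, joinAddr, hz, hn,
      Function.update_of_ne]

lemma eval_copyRecord (h7 : s.1 7 = 1) :
    (copyRecord.eval s).2 =
      update (update s.2 (s.1 2) (s.2 (s.1 10))) (s.1 9) (s.2 (s.1 10 + 1)) ∧
    ∀ i < 20, (copyRecord.eval s).1 i = s.1 i := by
  refine ⟨?_, fun i hi => ?_⟩ <;>
  simp (disch := omega) only [copyRecord, eval, Function.update_self, Function.update_of_ne, h7]

variable {A : Type*}

/-- The state while the new tree is assembled: the constants and addresses in the low registers are
in place, the registers in `L` point to the given objects, which occupy disjoint parts of `B` and of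
the memory allocated from `F` on, and the rest of the original memory `m` is unchanged except for
the record at `p`. -/
structure Working (m : ℕ → ℕ) (code : A → ℕ) (F p root : ℕ) (B : Set ℕ) (s : (ℕ → ℕ) × (ℕ → ℕ))
    (L : List (Obj A × ℕ)) : Prop where
  one : s.1 7 = 1
  zero : s.1 8 = 0
  root : s.1 0 = root
  node : s.1 2 = p
  word : s.1 9 = p + 1
  le : F ≤ s.1 1
  keep : ∀ z < F, z ≠ p + 1 → z ∉ B → s.2 z = m z
  heap : Heap s.2 code (B ∪ Set.Ico F (s.1 1)) (L.map fun y => (y.1, s.1 y.2))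

variable {m : ℕ → ℕ} {code : A → ℕ} {F p root : ℕ} {B : Set ℕ}

lemma Working.perm {L L' : List (Obj A × ℕ)} (h : Working m code F p root B s L)
    (hp : L.Perm L') : Working m code F p root B s L' :=
  { h with heap := h.heap.perm (hp.map _) }

lemma Working.pack {r : ℕ} {ts : List (SynTree A)} {L : List (Obj A × ℕ)}
    (h : Working m code F p root B s ((.forest ts, r) :: L)) (o : AccOp) (hF : 0 < F)
    (hB : ∀ z ∈ B, z < F) (hr : 9 < r ∧ r < 20) (hL : ∀ y ∈ L, y.2 ≠ r ∧ 9 < y.2 ∧ y.2 < 20) :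
    Working m code F p root B ((RamCmd.pack o r).eval s) ((.tree (ofForest o ts), r) :: L) := by
  obtain ⟨hm, hreg, hfree, hkeep⟩ := eval_pack (o := o) hr h.one h.zero
  have hle := h.le
  have hLmap : L.map (fun y => (y.1, ((RamCmd.pack o r).eval s).1 y.2)) =
      L.map fun y => (y.1, s.1 y.2) := by
    refine List.map_congr_left fun y hy => ?_
    rw [hkeep _ (hL y hy).2.2 (by have := (hL y hy).2.1; omega) (hL y hy).1]
  have hlt : ∀ z ∈ B ∪ Set.Ico F (s.1 1), z < s.1 1 := by
    rintro z (hz | hz)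
    exacts [(hB z hz).trans_le hle, hz.2]
  refine ⟨?_, ?_, ?_, ?_, ?_, ?_, fun z hz hzp hzB => ?_, ?_⟩
  · rw [hkeep 7 (by omega) (by omega) (by omega), h.one]
  · rw [hkeep 8 (by omega) (by omega) (by omega), h.zero]
  · rw [hkeep 0 (by omega) (by omega) (by omega), h.root]
  · rw [hkeep 2 (by omega) (by omega) (by omega), h.node]
  · rw [hkeep 9 (by omega) (by omega) (by omega), h.word]
  · omega
  · rw [hm, packMem_of_lt _ _ _ _ (hz.trans_le hle), h.keep z hz hzp hzB]
  · have := h.heap.pack o (hF.trans_le hle) hlt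
    rw [Set.union_assoc, Set.Ico_union_Ico_eq_Ico hle (Nat.le_add_right _ _)] at this
    rw [hm, hfree, List.map_cons, hLmap, hreg]
    exact this

lemma Working.join {r t : ℕ} {x y : Option (SynTree A)} {L : List (Obj A × ℕ)}
    (h : Working m code F p root B s ((.tree x, r) :: (.tree y, t) :: L)) (o : AccOp) (hF : 0 < F)
    (hB : ∀ z ∈ B, z < F) (hr : 9 < r ∧ r < 20) (ht : 9 < t ∧ t < 20)
    (hL : ∀ y ∈ L, y.2 ≠ r ∧ 9 < y.2 ∧ y.2 < 20) :
    Working m code F p root B ((RamCmd.join o r t).eval s)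
      ((.tree (ofForest o (x.toList ++ y.toList)), r) :: L) := by
  obtain ⟨hm, hreg, hfree, hkeep⟩ := eval_join (o := o) hr ht h.one h.zero
  have hle := h.le
  have hLmap : L.map (fun y => (y.1, ((RamCmd.join o r t).eval s).1 y.2)) =
      L.map fun y => (y.1, s.1 y.2) := by
    refine List.map_congr_left fun y hy => ?_
    rw [hkeep _ (hL y hy).2.2 (by have := (hL y hy).2.1; omega) (hL y hy).1]
  have hlt : ∀ z ∈ B ∪ Set.Ico F (s.1 1), z < s.1 1 := by
    rintro z (hz | hz)
    exacts [(hB z hz).trans_le hle, hz.2]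
  refine ⟨?_, ?_, ?_, ?_, ?_, ?_, fun z hz hzp hzB => ?_, ?_⟩
  · rw [hkeep 7 (by omega) (by omega) (by omega), h.one]
  · rw [hkeep 8 (by omega) (by omega) (by omega), h.zero]
  · rw [hkeep 0 (by omega) (by omega) (by omega), h.root]
  · rw [hkeep 2 (by omega) (by omega) (by omega), h.node]
  · rw [hkeep 9 (by omega) (by omega) (by omega), h.word]
  · omega
  · rw [hm, joinMem_of_lt _ _ _ _ _ (hz.trans_le hle), h.keep z hz hzp hzB]
  · have := h.heap.join o (hF.trans_le hle) hlt
    rw [Set.union_assoc, Set.Ico_union_Ico_eq_Ico hle (Nat.le_add_right _ _)] at this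
    rw [hm, hfree, List.map_cons, hLmap, hreg]
    exact this

/-- With suitable parameters, the program turns a stored node into the tree that arises from it by
a given merge, in the place of the node and in fresh memory. -/
lemma exists_eval_merge {t y : SynTree A} (hty : Merge t y) {S : Set ℕ}
    (ht : TreeAt m code t p S) (hF : 0 < F) (hSF : ∀ z ∈ S, z < F) (root : ℕ) :
    ∃ h : Fin 5 → ℕ, (∀ i, h i < F) ∧ ∀ reg : ℕ → ℕ, reg 0 = root → reg 1 = F →
      (∀ i : Fin 5, reg (i + 2) = h i) → ∃ T,
      TreeAt (merge.eval (reg, m)).2 code y p T ∧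
      F ≤ (merge.eval (reg, m)).1 1 ∧ T ⊆ S ∪ Set.Ico F ((merge.eval (reg, m)).1 1) ∧
      (merge.eval (reg, m)).1 0 = root ∧
      ∀ z < F, z ∉ S → (merge.eval (reg, m)).2 z = m z := by
  obtain ⟨h₁, h₂, hf₁, hf₂, hy⟩ := hty
  rename_i c cs l₁ l₂ l₃ l₄ t₁ t₂ P₁ S₁ P₂ S₂
  obtain ⟨-, hp0, B, hB, hpB, hpB', rfl⟩ := treeAt_node.1 ht
  have hBF : ∀ z ∈ B, z < F := fun z hz => hSF z (.inr hz)
  have hpF : p < F := hSF p (by simp)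
  have hpF' : p + 1 < F := hSF (p + 1) (by simp)
  rw [h₁] at hB
  have heap₀ : Heap m code B [(.forest (l₁ ++ t₁ :: l₂), m (p + 1))] :=
    ⟨B, subset_rfl, hB, trivial⟩
  -- The second child is taken out of the memory that is left by taking out the first.
  obtain ⟨w₁, a₁, hw₁, ha₁, hk₁, heap₁⟩ := heap₀.take hpB' hf₁
  rw [h₂] at heap₁
  obtain ⟨w₂, a₂, hw₂, ha₂, hk₂, heap₂⟩ := heap₁.take hpB' hf₂
  refine ⟨![p, w₁, w₂, a₁, a₂], ?_, fun reg r0 r1 hreg => ?_⟩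
  · have hw : ∀ w, w = p + 1 ∨ w ∈ B → w < F := by
      rintro w (rfl | hw)
      exacts [hpF', hBF w hw]
    have ha : ∀ a, a = 0 ∨ a ∈ B → a < F := by
      rintro a (rfl | ha)
      exacts [hF, hBF a ha]
    intro i
    fin_cases i
    exacts [hpF, hw _ hw₁, hw _ hw₂, ha _ ha₁, ha _ ha₂]
  have r2 : reg 2 = p := hreg 0
  have r3 : reg 3 = w₁ := hreg 1
  have r4 : reg 4 = w₂ := hreg 2
  have r5 : reg 5 = a₁ := hreg 3
  have r6 : reg 6 = a₂ := hreg 4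
  simp only [merge, eval]
  -- The registers after the constants have been set.
  have b0 : ∀ i < 7, update (update (update reg 7 1) 8 0) 9
      (update (update reg 7 1) 8 0 2 + update (update reg 7 1) 8 0 7) i = reg i := by
    intro i hi
    simp (disch := omega) only [Function.update_of_ne]
  have b7 : update (update (update reg 7 1) 8 0) 9
      (update (update reg 7 1) 8 0 2 + update (update reg 7 1) 8 0 7) 7 = 1 := by simp
  have b8 : update (update (update reg 7 1) 8 0) 9
      (update (update reg 7 1) 8 0 2 + update (update reg 7 1) 8 0 7) 8 = 0 := by simp
  have b9 : update (update (update reg 7 1) 8 0) 9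
      (update (update reg 7 1) 8 0 2 + update (update reg 7 1) 8 0 7) 9 = p + 1 := by
    simp [r2]
  generalize update (update (update reg 7 1) 8 0) 9
      (update (update reg 7 1) 8 0 2 + update (update reg 7 1) 8 0 7) = reg' at b0 b7 b8 b9 ⊢
  have take₁ := eval_take (s := (reg', m)) (w := 3) (a := 5) (d := 10) (e := 11) (by omega)
    (by omega) (by omega) (by omega) (by omega) b7 b8 rfl
  generalize (split 5 10 11).eval _ = s₁ at take₁ ⊢
  obtain ⟨m₁, d₁, e₁, k₁⟩ := take₁
  simp only [b0 3 (by omega), b0 5 (by omega), r3, r5] at m₁ d₁ e₁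
  have take₂ := eval_take (s := s₁) (w := 4) (a := 6) (d := 12) (e := 13) (by omega)
    (by omega) (by omega) (by omega) (by omega) ((k₁ 7 (by omega) (by omega) (by omega)).trans b7)
    ((k₁ 8 (by omega) (by omega) (by omega)).trans b8) rfl
  generalize (split 6 12 13).eval _ = s₂ at take₂ ⊢
  obtain ⟨m₂, d₂, e₂, k₂⟩ := take₂
  rw [k₁ 4 (by omega) (by omega) (by omega), k₁ 6 (by omega) (by omega) (by omega), m₁] at m₂ d₂ e₂
  simp only [b0 4 (by omega), b0 6 (by omega), r4, r6] at m₂ d₂ e₂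
  have low : ∀ i < 10, s₂.1 i = reg' i := fun i hi => by
    rw [k₂ i (by omega) (by omega) (by omega), k₁ i (by omega) (by omega) (by omega)]
  have W : Working m code F p root B (update s₂.1 14 (s₂.2 (s₂.1 9)), s₂.2)
      [(.forest P₁, 10), (.forest P₂, 12), (.forest S₁, 11), (.forest S₂, 13),
        (.forest (l₃ ++ l₄), 14)] := by
    refine ⟨?_, ?_, ?_, ?_, ?_, ?_, fun z hz hzp hzB => ?_, ?_⟩
    · simpa [low] using b7
    · simpa [low] using b8
    · simpa [low, b0] using r0
    · simpa [low, b0] using r2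
    · simpa [low] using b9
    · simp [low, b0, r1]
    · exact (congrFun m₂ z).trans ((hk₂ z hzp hzB).trans (hk₁ z hzp hzB))
    · have h10 : s₂.1 10 = takeFst m w₁ a₁ := by
        rw [k₂ 10 (by omega) (by omega) (by omega), d₁]
      have h11 : s₂.1 11 = takeSnd m w₁ a₁ := by
        rw [k₂ 11 (by omega) (by omega) (by omega), e₁]
      have h14 : ∀ i < 14, update s₂.1 14 (s₂.2 (s₂.1 9)) i = s₂.1 i := fun i hi =>
        Function.update_of_ne (by omega) _ _
      simp only [List.map_cons, List.map_nil, h14 10 (by omega), h14 11 (by omega),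
        h14 12 (by omega), h14 13 (by omega), Function.update_self]
      rw [h10, h11, d₂, e₂, low 9 (by omega), b9, m₂]
      refine (heap₂.congr_mono (fun _ _ => rfl) Set.subset_union_left).perm ?_
      classical
      exact List.perm_iff_count.2 fun x => by simp only [List.count_cons]; omega
  -- The two upper parts are accumulated, then the two lower parts, then these two results, and
  -- finally the remaining children are added.
  have W₁ := ((W.pack .prior hF hBF (by omega) (by simp)).perm (.swap ..)).pack .prior hF hBF
    (by omega) (by simp)
  have W₂ := (W₁.perm (.swap ..)).join .pareto hF hBF (by omega) (by omega) (by simp)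
  have W₃ := (W₂.perm ((List.Perm.swap ..).trans (.cons _ (.swap ..)))).pack .prior hF hBF
    (by omega) (by simp)
  have W₄ := ((W₃.perm (.swap ..)).pack .prior hF hBF (by omega) (by simp)).perm (.swap ..)
  have W₅ := (W₄.join .pareto hF hBF (by omega) (by omega) (by simp)).perm (.swap ..)
  have W₆ := (W₅.join .prior hF hBF (by omega) (by omega) (by simp)).perm (.swap ..)
  have W₇ := (W₆.pack .pareto hF hBF (by omega) (by simp)).perm (.swap ..)
  have W₈ := W₇.join .pareto hF hBF (by omega) (by omega) (by simp)
  generalize (join .pareto 10 14).eval _ = s₃ at W₈ ⊢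
  rw [← mergeTree, hy] at W₈
  clear W W₁ W₂ W₃ W₄ W₅ W₆ W₇
  obtain ⟨hmem, hregs⟩ := eval_copyRecord W₈.one
  rw [W₈.node, W₈.word] at hmem
  obtain ⟨T, hT, hTy, -⟩ := W₈.heap
  have hnot : ∀ z ∈ T, z ≠ p ∧ z ≠ p + 1 := by
    intro z hz
    constructor <;> rintro rfl
    · exact (hT hz).elim hpB fun h => absurd h.1 (by omega)
    · exact (hT hz).elim hpB' fun h => absurd h.1 (by omega)
  obtain ⟨T', hT', hTT'⟩ := TreeAt.copy (m' := (copyRecord.eval s₃).2) hTy hp0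
    (fun h => (hnot p h).1 rfl) (fun h => (hnot _ h).2 rfl)
    (fun z hz => by
      rw [hmem, Function.update_of_ne (hnot z hz).2, Function.update_of_ne (hnot z hz).1])
    (by rw [hmem, Function.update_of_ne (by omega), Function.update_self])
    (by rw [hmem, Function.update_self])
  rw [hregs 1 (by omega), hregs 0 (by omega)]
  refine ⟨T', hT', W₈.le, fun z hz => ?_, W₈.root, fun z hz hzS => ?_⟩
  · rcases hTT' hz with h | h
    · exact .inl (.inl h)
    · exact (hT h).imp_left .inr
  · simp only [Set.mem_union, Set.mem_insert_iff, Set.mem_singleton_iff, not_or] at hzS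
    rw [hmem, Function.update_of_ne hzS.1.2, Function.update_of_ne hzS.1.1,
      W₈.keep z hz hzS.1.2 hzS.2]

end RamCmd

/-- The program carries out any given rewriting of a stored tree. -/
theorem exists_haltsWithin_of_rewrite {A : Type*} {m : ℕ → ℕ} {code : A → ℕ} {t t' : SynTree A}
    (hr : SynTree.Rewrite t t') {root F : ℕ} (ht : t.Layout m code root F) :
    ∃ h : Fin 5 → ℕ, (∀ i, h i < F) ∧ ∃ s : RamState,
      (ramInit m root F h).HaltsWithin (RamCmd.merge.compile 0) RamCmd.merge.size s ∧
      t'.Layout s.mem code (s.reg 0) (s.reg 1) := by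
  obtain ⟨l, hl, hnd, hlF⟩ := ht
  have hS : SynTree.TreeAt m code t root {x | x ∈ l} := ⟨l, hl, hnd, fun x hx => (hlF x hx).1, rfl⟩
  obtain ⟨u, u', p, T, hu, hT, hTS, hrep⟩ := hS.rewrite hr
  have hTF : ∀ z ∈ T, z < F := fun z hz => (hlF z (hTS hz)).2
  have hF : 0 < F := (hTF p hT.mem).pos
  obtain ⟨h, hh, hrun⟩ := RamCmd.exists_eval_merge hu hT hF hTF root
  obtain ⟨T', hT', hle, hTT', hroot, hkeep⟩ := hrun (ramInit m root F h).reg (by simp [ramInit])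
    (by simp [ramInit]) (fun i => by simp [ramInit])
  have hrun' := RamCmd.haltsWithin_compile RamCmd.merge ((ramInit m root F h).reg, m) le_rfl
  generalize RamCmd.merge.eval ((ramInit m root F h).reg, m) = e at hT' hle hTT' hroot hkeep hrun'
  refine ⟨h, hh, ⟨RamCmd.merge.size, e.1, e.2⟩, hrun', ?_⟩
  obtain ⟨S', ⟨l', hl', hnd', hpos', rfl⟩, hS'⟩ := hrep e.2 T'
    (fun z hz => hkeep z (hlF z hz.1).2 hz.2) hT' (Set.disjoint_left.2 fun z hz hz' =>
      (hTT' hz).elim hz'.2 fun h => absurd (hlF z hz'.1).2 (not_lt.2 h.1))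
  rw [← hroot] at hl'
  refine ⟨l', hl', hnd', fun z hz => ⟨hpos' z hz, ?_⟩⟩
  change z < e.1 1
  rcases hS' hz with h | h
  · exact (hlF z h.1).2.trans_le hle
  · rcases hTT' h with h | h
    · exact (hTF z h).trans_le hle
    · exact h.2

theorem mainTheorem7 :
    -- the number of minimal p-extensions
    (∃ C : ℕ, ∀ (A : Type u) [Fintype A] (D : A → Type v) [∀ a, Infinite (D a)]
      (gt : ∀ a, D a → D a → Prop) [∀ a, IsStrictTotalOrder (D a) (gt a)],
      ∀ R ∈ fullPSkyline gt,
        (minPExtensions gt R).Finite ∧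
        (minPExtensions gt R).ncard ≤ C * Fintype.card A ^ 4) ∧
    -- the number of all p-extensions, attained at the skyline relation
    (∀ (A : Type u) [Fintype A] (D : A → Type v) [∀ a, Infinite (D a)]
      (gt : ∀ a, D a → D a → Prop) [∀ a, IsStrictTotalOrder (D a) (gt a)],
      2 ≤ Fintype.card A →
        (∃ R, IsSkylineRel gt R) ∧
        ∀ R, IsSkylineRel gt R →
          (pExtensions gt R).Finite ∧
          (Fintype.card A).factorial ≤ (pExtensions gt R).ncard) ∧
    -- the time needed to construct a minimal p-extension
    (∃ (P : List RamInstr) (k C : ℕ),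
      ∀ (A : Type u) [Fintype A] (D : A → Type v) [∀ a, Infinite (D a)]
        (gt : ∀ a, D a → D a → Prop) [∀ a, IsStrictTotalOrder (D a) (gt a)]
        (code : A ≃ Fin (Fintype.card A)),
      ∀ R ∈ fullPSkyline gt, ∀ T : SynTree A, T.IsSyntaxTreeOf gt R → T.IsNormalized →
      ∀ (m : ℕ → ℕ) (root F : ℕ), T.Layout m (fun a => (code a : ℕ)) root F →
      ∀ R' ∈ minPExtensions gt R,
        ∃ h : Fin k → ℕ, (∀ i, h i < F) ∧
        ∃ s : RamState, (ramInit m root F h).HaltsWithin P (C * Fintype.card A) s ∧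
        ∃ T' : SynTree A, T'.IsSyntaxTreeOf gt R' ∧
          T'.Layout s.mem (fun a => (code a : ℕ)) (s.reg 0) (s.reg 1)) := by
  refine ⟨⟨25, ?_⟩, ?_, RamCmd.merge.compile 0, 5, RamCmd.merge.size, ?_⟩
  · intro A _ D _ gt _ R hR
    refine ⟨(finite_fullPSkyline gt).subset fun _ h => h.1.1,
      (ncard_minPExtensions_le gt hR).trans (Nat.mul_le_mul_left _ ?_)⟩
    rcases Nat.eq_zero_or_pos (Fintype.card A) with h | h
    · simp [h]
    · exact Nat.pow_le_pow_right h (by omega)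
  · intro A _ D _ gt _ hA
    have : Nonempty A := Fintype.card_pos_iff.1 (by omega)
    exact ⟨exists_isSkylineRel gt, fun R hR => ⟨(finite_fullPSkyline gt).subset fun _ h => h.1,
      factorial_le_ncard_pExtensions gt hA hR⟩⟩
  · rintro A _ D _ gt _ code R - T ⟨hp, hf, rfl⟩ hn m root F hl R' hR'
    obtain ⟨T', hr, hT'⟩ := SynTree.exists_rewrite_of_mem_minPExtensions gt ⟨hp, hf.1⟩ hn hf.2 hR'
    obtain ⟨h, hh, s, ⟨u, hu, hs⟩, hl'⟩ := exists_haltsWithin_of_rewrite hr hl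
    obtain ⟨a, -⟩ := T.vars_nonempty
    have hA : 0 < Fintype.card A := Fintype.card_pos_iff.2 ⟨a⟩
    exact ⟨h, hh, s, ⟨u, hu.trans (Nat.le_mul_of_pos_right _ hA), hs⟩, T', hT', hl'⟩
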